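/- A metric measure space is a triple $\mathfrak{Z}=(Z,\rho,\mu)$, where $Z$ is a nonempty set, $\rho$ is a metric on $Z$ and $\mu$ is a nonnegative Borel measure such that every open ball $B(x,s)=\{y\in Z:\rho(x,y)<s\}$, $x\in Z$, $s\in(0,\infty)$, satisfies $0<\mu(B(x,s))<\infty$. For $\kappa\in[1,\infty)$ and $f\colon Z\to\mathbb{C}$ integrable on every ball, the modified centered and noncentered Hardy--Littlewood maximal operators are $$\mathcal{M}^{\rm c}_{\kappa,\mathfrak{Z}}f(x)=\sup_{s\in(0,\infty)}\frac{1}{\mu(B(x,\kappa s))}\int_{B(x,s)}|f|\,d\mu,\qquad \mathcal{M}_{\kappa,\mathfrak{Z}}f(x)=\sup_{\substack{c\in Z,\ s\in(0,\infty)\\ x\in B(c,s)}}\frac{1}{\mu(B(c,\kappa s))}\int_{B(c,s)}|f|\,d\mu.$$ An operator $\mathcal{H}$ is of weak type $(p,p)$, $p\in[1,\infty)$, if there is a constant $C<\infty$ such that $\lambda\,\mu(\{x\in Z:|\mathcal{H}f(x)|>\lambda\})^{1/p}\le C\|f\|_p$ for all $f\in L^p(\mathfrak{Z})$ and $\lambda\in(0,\infty)$;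 it is of weak type $(\infty,\infty)$ if there is $C<\infty$ with $\|\mathcal{H}f\|_\infty\le C\|f\|_\infty$ for all $f\in L^\infty(\mathfrak{Z})$. Theorem. Let $h^{\rm c}\colon[1,2]\to[1,\infty]$ and $h\colon[1,3]\to[1,\infty]$ be nonincreasing functions such that $h(\kappa)\ge h^{\rm c}(\kappa)$ for each $\kappa\in[1,2]$ and $h^{\rm c}(2)=h(3)=1$. Then there exists a metric measure space $\mathfrak{Z}$ such that for each $\kappa\in[1,2)$ and each $p\in[1,\infty]$ the operator $\mathcal{M}^{\rm c}_{\kappa,\mathfrak{Z}}$ is of weak type $(p,p)$ if and only if $p>h^{\rm c}(\kappa)$ or $p=\infty$, while for each $\kappa\in[1,3)$ and each $p\in[1,\infty]$ the operator $\mathcal{M}_{\kappa,\mathfrak{Z}}$ is of weak type $(p,p)$ if and only if $p>h(\kappa)$ or $p=\infty$. -/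

import Mathlib

open MeasureTheory
open scoped ENNReal NNReal

/-- The modified centered Hardy-Littlewood maximal function
`x ↦ sup_{s > 0} |B(x, κ s)|⁻¹ ∫_{B(x, s)} |f| dμ`.
Balls with `|B(x, s)| = 0` or `|B(x, κ s)| = ∞` contribute `0`, so they play no role. -/
noncomputable def centeredMaximal {X : Type*} [MetricSpace X] [MeasurableSpace X]
    (μ : Measure X) (κ : ℝ) (f : X → ℂ) (x : X) : ℝ≥0∞ :=
  ⨆ (s : ℝ) (_ : 0 < s),
    (∫⁻ y in Metric.ball x s, ‖f y‖ₑ ∂μ) / μ (Metric.ball x (κ * s))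

/-- The modified noncentered Hardy-Littlewood maximal function
`x ↦ sup_{B ∋ x} |κ B|⁻¹ ∫_B |f| dμ`. A ball is given by a center `c` and a radius `s > 0`, and
`κ B` has the same center and radius `κ s`.
Balls with `|B| = 0` or `|κ B| = ∞` contribute `0`, so they play no role. -/
noncomputable def noncenteredMaximal {X : Type*} [MetricSpace X] [MeasurableSpace X]
    (μ : Measure X) (κ : ℝ) (f : X → ℂ) (x : X) : ℝ≥0∞ :=
  ⨆ (c : X) (s : ℝ) (_ : 0 < s) (_ : x ∈ Metric.ball c s),
    (∫⁻ y in Metric.ball c s, ‖f y‖ₑ ∂μ) / μ (Metric.ball c (κ * s))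

/-- The weak `L^p` quasinorm of a function `g ≥ 0`: for finite `p` it is
`sup_{t > 0} t * |{g > t}|^{1/p}`, and for `p = ∞` the essential supremum. -/
noncomputable def weakLpNorm {X : Type*} [MeasurableSpace X]
    (μ : Measure X) (p : ℝ≥0∞) (g : X → ℝ≥0∞) : ℝ≥0∞ :=
  if p = ∞ then essSup g μ
  else ⨆ (t : ℝ≥0) (_ : 0 < t), (t : ℝ≥0∞) * μ {x | (t : ℝ≥0∞) < g x} ^ (1 / p.toReal)

/-- The operator `T` is of weak type `(p, p)`: it is bounded from `L^p` to weak `L^p`. -/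
def IsWeakType {X : Type*} [MeasurableSpace X]
    (μ : Measure X) (p : ℝ≥0∞) (T : (X → ℂ) → X → ℝ≥0∞) : Prop :=
  ∃ C : ℝ≥0, ∀ f : X → ℂ, MemLp f p μ → weakLpNorm μ p (T f) ≤ C * eLpNorm f p μ

/-! The space is a union of widely separated finite stars. The `n`-th star has a core of mass `1`,
`N = num n` midpoints of total mass `1`, and `N` tips of mass `2 ^ n` each. A ball reaching from a
tip to the core, whose dilation misses all other tips, turns the indicator of the core into a
function of size about `2 ^ (-n)` at that tip. If this happens at every tip, the weak type `(p, p)`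
inequality forces `N * 2 ^ n ≲ (2 ^ n) ^ p`. For `N ≈ (n + 1) * 2 ^ (n * (e n - 1))` this fails
along every infinite set of `n` with `p ≤ e n`, and holds uniformly where `e n ≤ q' < p`.

The metric decides for which `κ` such balls exist. A ball around a midpoint always reaches core and
tip with radius just above `1`, and its dilation misses the other tips as long as `κ < far n`: this
serves the noncentered operator. The centered operator needs the ball around the tip itself. It
works for `κ < far n` when the tips are at distance `1` from the core (`inner n`, which requires
`far n ≤ 2`). Otherwise the tips are as far from the core as from each other, and a ball around a
tip that reaches the core already contains all tips.

A star thus excludes a rectangle of pairs `(κ, p)`, and `exists_rectangles` writes an antitone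
function as an upper limit of countably many rectangles. Inner stars encode `hc`, the others `h`;
since `hc ≤ h`, the inner stars do not disturb the noncentered operator. The positive results rest
on `ball_classification`: every other kind of ball is harmless, by Hölder's inequality and
disjointness. -/

/-! ### Encoding antitone functions by countably many rectangles -/

open Filter in
/-- A countable family of points that detects every strict sublevel set of an antitone function. -/
lemma exists_seq_detecting_sublevel {b : ℝ} (hb : 1 < b) {h : ℝ → ℝ≥0∞}
    (h_anti : AntitoneOn h (Set.Icc 1 b)) :
    ∃ d : ℕ → ℝ, (∀ i, d i ∈ Set.Ico 1 b) ∧ (∃ i, d i = 1) ∧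
      ∀ κ ∈ Set.Ico 1 b, ∀ r, h κ < r → ∃ i, d i = κ ∨ (d i < κ ∧ h (d i) < r) := by
  -- Rationals detect `κ` unless it is the least point of a sublevel set; rational thresholds
  -- suffice for these least points, so they are countably many.
  set D : Set ℝ := ({1} ∪ (Set.range ((↑) : ℚ → ℝ) ∪ Set.range fun r : ℚ =>
    sInf {x ∈ Set.Ico 1 b | h x < ((r : ℝ).toNNReal : ℝ≥0∞)})) ∩ Set.Ico 1 b with hD
  have hcount : D.Countable :=
    (((Set.countable_singleton _).union
      ((Set.countable_range _).union (Set.countable_range _)))).mono Set.inter_subset_left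
  have h1 : (1 : ℝ) ∈ D := ⟨Or.inl rfl, le_rfl, hb⟩
  obtain ⟨d, hd⟩ := hcount.exists_eq_range ⟨1, h1⟩
  have hmem : ∀ x ∈ D, ∃ i, d i = x := fun x hx => by rw [hd] at hx; exact hx
  refine ⟨d, fun i => ?_, hmem 1 h1, fun κ hκ r hr => ?_⟩
  · have : d i ∈ D := hd ▸ Set.mem_range_self i
    exact this.2
  obtain ⟨ρ, -, hρ1, hρ2⟩ := ENNReal.lt_iff_exists_rat_btwn.1 hr
  by_cases hy : ∃ y ∈ Set.Ico 1 b, h y < ((ρ : ℝ).toNNReal : ℝ≥0∞) ∧ y < κ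
  · obtain ⟨y, hyI, hyρ, hyκ⟩ := hy
    obtain ⟨z, hz1, hz2⟩ := exists_rat_btwn hyκ
    have hzI : (z : ℝ) ∈ Set.Ico 1 b := ⟨hyI.1.trans hz1.le, hz2.trans hκ.2⟩
    obtain ⟨i, hi⟩ := hmem z ⟨Or.inr (Or.inl ⟨z, rfl⟩), hzI⟩
    refine ⟨i, Or.inr ⟨hi ▸ hz2, ?_⟩⟩
    rw [hi]
    exact ((h_anti ⟨hyI.1, hyI.2.le⟩ ⟨hzI.1, hzI.2.le⟩ hz1.le).trans_lt hyρ).trans hρ2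
  · push Not at hy
    have hleast : IsLeast {x ∈ Set.Ico 1 b | h x < ((ρ : ℝ).toNNReal : ℝ≥0∞)} κ :=
      ⟨⟨hκ, hρ1⟩, fun y hy' => hy y hy'.1 hy'.2⟩
    obtain ⟨i, hi⟩ := hmem κ ⟨Or.inr (Or.inr ⟨ρ, hleast.csInf_eq⟩), hκ⟩
    exact ⟨i, Or.inl hi⟩

open Filter in
/-- An antitone function `h` on `[1, b)` is the upper limit of countably many rectangles
`[1, τ n) × [1, e n]`. -/
lemma exists_rectangles {b : ℝ} (hb : 1 < b) {h : ℝ → ℝ≥0∞}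
    (one_le : ∀ κ ∈ Set.Icc 1 b, 1 ≤ h κ) (h_anti : AntitoneOn h (Set.Icc 1 b)) :
    ∃ τ e : ℕ → ℝ, (∀ n, 1 < τ n) ∧ (∀ n, τ n ≤ b) ∧ (∀ n, 1 ≤ e n) ∧
      ∀ κ ∈ Set.Ico 1 b, ∀ q : ℝ,
        (ENNReal.ofReal q ≤ h κ → ∃ᶠ n in atTop, κ < τ n ∧ q ≤ e n) ∧
        (h κ < ENNReal.ofReal q → ∃ q' < q, ∀ᶠ n in atTop, κ < τ n → e n ≤ q') := by
  obtain ⟨d, hdI, ⟨i₁, hi₁⟩, hd⟩ := exists_seq_detecting_sublevel hb h_anti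
  have hdI' : ∀ i, d i ∈ Set.Icc 1 b := fun i => ⟨(hdI i).1, (hdI i).2.le⟩
  -- At stage `m` the grid is `d 0, …, d m`, and `t m j` is the grid point following `d j`, or `b`
  -- if there is none.
  let G : ℕ → ℕ → Finset ℝ := fun m j =>
    insert b (((Finset.range (m + 1)).filter fun i => d j < d i).image d)
  have hG : ∀ m j, (G m j).Nonempty := fun m j => Finset.insert_nonempty _ _
  let t : ℕ → ℕ → ℝ := fun m j => (G m j).min' (hG m j)
  have ht : ∀ m j κ, κ < t m j ↔ κ < b ∧ ∀ i ≤ m, d j < d i → κ < d i := by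
    intro m j κ
    simp only [t, Finset.lt_min'_iff, G, Finset.forall_mem_insert, Finset.forall_mem_image,
      Finset.mem_filter, Finset.mem_range, Nat.lt_succ_iff, and_imp]
  -- The cap `m` keeps the exponent finite where `h = ∞`. Pairs with `j > m` are dummies of exponent
  -- `1`, below every `r > h κ ≥ 1`.
  let a : ℕ → ℕ → ℝ := fun m j => if j ≤ m then max 1 (min (h (d j)) m).toReal else 1
  refine ⟨fun n => t n.unpair.1 n.unpair.2, fun n => a n.unpair.1 n.unpair.2, fun n => ?_,
    fun n => ?_, fun n => ?_, fun κ hκ q => ⟨fun hq => ?_, fun hq => ?_⟩⟩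
  · exact (ht _ _ _).2 ⟨hb, fun i _ hi => (hdI _).1.trans_lt hi⟩
  · exact Finset.min'_le _ _ (Finset.mem_insert_self _ _)
  · simp only [a]; split_ifs <;> simp
  · rw [frequently_atTop]
    intro n₀
    set m := max n₀ (max i₁ ⌈q⌉₊) with hm
    -- The last grid point left of `κ`: its successor exceeds `κ`, and `h` is at least `h κ` there.
    obtain ⟨j, hj, hjmax⟩ := Finset.exists_max_image
      ((Finset.range (m + 1)).filter fun i => d i ≤ κ) d
      ⟨i₁, by simp [hi₁, hκ.1, hm]⟩
    simp only [Finset.mem_filter, Finset.mem_range, Nat.lt_succ_iff] at hj hjmax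
    refine ⟨Nat.pair m j, (le_max_left _ _).trans (Nat.left_le_pair m j), ?_, ?_⟩
    · simp only [Nat.unpair_pair]
      refine (ht _ _ _).2 ⟨hκ.2, fun i hi hji => ?_⟩
      by_contra! hcon
      exact absurd (hjmax i ⟨hi, hcon⟩) (not_le.2 hji)
    · simp only [Nat.unpair_pair, a, if_pos hj.1]
      refine le_max_of_le_right ?_
      rw [← ENNReal.ofReal_le_iff_le_toReal (by simp)]
      refine le_min (hq.trans (h_anti (hdI' j) ⟨hκ.1, hκ.2.le⟩ hj.2)) ?_
      rw [← ENNReal.ofReal_natCast]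
      refine ENNReal.ofReal_le_ofReal ((Nat.le_ceil q).trans ?_)
      exact_mod_cast (le_max_right _ _).trans (le_max_right _ _)
  · obtain ⟨r, hr1, hr2⟩ := ENNReal.lt_iff_exists_nnreal_btwn.1 hq
    have hκ' : κ ∈ Set.Icc 1 b := ⟨hκ.1, hκ.2.le⟩
    have h1r : (1 : ℝ) ≤ r := by
      have := (one_le κ hκ').trans hr1.le
      exact_mod_cast this
    refine ⟨r, ?_, ?_⟩
    · have hq0 : 0 < q := ENNReal.ofReal_pos.1 (bot_le.trans_lt hr2)
      rw [← ENNReal.ofReal_coe_nnreal] at hr2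
      exact (ENNReal.ofReal_lt_ofReal_iff hq0).1 hr2
    · obtain ⟨i, hi⟩ := hd κ hκ r hr1
      -- Once the detecting point `d i` is in the grid, `κ < t m j` keeps `d j` from lying left of
      -- it, so `h (d j) < r`. Only finitely many non-dummy pairs come before that stage.
      have hfin : {n : ℕ | n.unpair.1 < i ∧ n.unpair.2 ≤ n.unpair.1}.Finite := by
        refine Set.Finite.subset (((Set.finite_Iio i).prod (Set.finite_Iio i)).image
          fun x => Nat.pair x.1 x.2) fun n hn => ⟨n.unpair, ⟨hn.1, hn.2.trans_lt hn.1⟩, ?_⟩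
        exact Nat.pair_unpair n
      rw [← Nat.cofinite_eq_atTop]
      filter_upwards [hfin.compl_mem_cofinite] with n hn hlt
      simp only [a]
      split_ifs with hjm
      · have him : i ≤ n.unpair.1 := by
          by_contra! hcon
          exact hn ⟨hcon, hjm⟩
        have hgrid := ((ht _ _ _).1 hlt).2 i him
        refine max_le h1r (ENNReal.toReal_le_of_le_ofReal r.2 ?_)
        rw [ENNReal.ofReal_coe_nnreal]
        refine (min_le_left _ _).trans ?_
        rcases hi with hi | ⟨hi, hir⟩
        · have : κ ≤ d n.unpair.2 := by
            by_contra! hcon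
            exact absurd (hgrid (hi ▸ hcon)) (by simp [hi])
          exact (h_anti hκ' (hdI' _) this).trans hr1.le
        · have : d i ≤ d n.unpair.2 := by
            by_contra! hcon
            exact absurd (hgrid hcon) (not_lt.2 hi.le)
          exact (h_anti (hdI' _) (hdI' _) this).trans hir.le
      · exact h1r

/-! ### The stars and their metric -/

/-- A sequence of shapes of starlike pieces: the `n`-th piece has `num n` branches, distinct branches
are at distance about `far n`, and the tips are at distance `1` from the core if `inner n`. -/
structure StarShape where
  num : ℕ → ℕ
  num_pos : ∀ n, 0 < num n
  far : ℕ → ℝ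
  one_lt_far : ∀ n, 1 < far n
  far_le_three : ∀ n, far n ≤ 3
  inner : ℕ → Prop
  far_le_two : ∀ n, inner n → far n ≤ 2

/-- The points of a star whose branches, labelled by `ι`, consist of a midpoint and a tip. -/
inductive StarNode (ι : Type) : Type
  | core : StarNode ι
  | mid (i : ι) : StarNode ι
  | tip (i : ι) : StarNode ι

namespace StarNode

variable {ι : Type}

/-- The label of the branch containing a point. -/
def branch : StarNode ι → Option ι
  | core => none
  | mid i => some i
  | tip i => some i

/-- Relabelling of branches. -/
def map {κ : Type} (g : ι → κ) : StarNode ι → StarNode κ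
  | core => core
  | mid i => mid (g i)
  | tip i => tip (g i)

open Classical in
/-- The distance in a star with core-tip distance `r` and distance `t` between different branches. -/
noncomputable def dist (r t : ℝ) : StarNode ι → StarNode ι → ℝ
  | core, core => 0
  | core, mid _ => 1
  | mid _, core => 1
  | core, tip _ => r
  | tip _, core => r
  | mid i, mid j => if i = j then 0 else min t 2
  | tip i, tip j => if i = j then 0 else min t 2
  | mid i, tip j => if i = j then 1 else t
  | tip i, mid j => if i = j then 1 else t

lemma dist_map {κ : Type} {g : ι → κ} (hg : Function.Injective g) (r t : ℝ) (a b : StarNode ι) :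
    dist r t (a.map g) (b.map g) = dist r t a b := by
  cases a <;> cases b <;> simp only [map, dist] <;> congr 1 <;> simp [hg.eq_iff]

lemma map_injective {κ : Type} {g : ι → κ} (hg : Function.Injective g) :
    Function.Injective (map g) := by
  intro a b h
  cases a <;> cases b <;> simp_all [map, hg.eq_iff]

instance [Countable ι] : Countable (StarNode ι) := by
  let g : StarNode ι → Option (Bool × ι) := fun
    | core => none
    | mid i => some (false, i)
    | tip i => some (true, i)
  refine Function.Injective.countable (f := g) fun a b h => ?_
  cases a <;> cases b <;> simp_all [g]

variable {r t : ℝ}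

lemma dist_self (a : StarNode ι) : dist r t a a = 0 := by cases a <;> simp [dist]

lemma dist_comm (a b : StarNode ι) : dist r t a b = dist r t b a := by
  cases a <;> cases b <;> simp only [dist] <;> congr 1 <;> simp [eq_comm]

lemma one_le_dist (hr : 1 ≤ r) (ht : 1 < t) {a b : StarNode ι} (hab : a ≠ b) :
    1 ≤ dist r t a b := by
  have : 1 ≤ min t 2 := le_min ht.le one_le_two
  cases a <;> cases b <;> simp_all [dist] <;> split_ifs <;> linarith

lemma dist_le_three (hr : r ≤ 2) (ht : t ≤ 3) (a b : StarNode ι) : dist r t a b ≤ 3 := by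
  have : min t 2 ≤ 2 := min_le_right _ _
  cases a <;> cases b <;> simp only [dist] <;> (try split_ifs) <;> linarith

/-- The critical path runs from a midpoint through the core to the tip of another branch, so `t ≤ 1
+ r` is needed: this is why `r = 1` demands `t ≤ 2`, while `r = min t 2` allows `t` up to `3`. -/
lemma dist_triangle (ht : 1 < t) (ht3 : t ≤ 3) (hr : r = min t 2 ∨ r = 1 ∧ t ≤ 2)
    (a b c : StarNode ι) : dist r t a c ≤ dist r t a b + dist r t b c := by
  have h1 : 1 < min t 2 := lt_min ht one_lt_two
  have h2 : min t 2 ≤ 2 := min_le_right _ _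
  have h3 : min t 2 ≤ t := min_le_left _ _
  have h4 : t ≤ 1 + min t 2 := by rcases min_choice t 2 with h | h <;> rw [h] <;> linarith
  have h5 : r ≤ min t 2 := by rcases hr with h | h <;> linarith
  have h6 : t ≤ r + 1 := by rcases hr with h | h <;> linarith
  have h7 : 1 ≤ r := by rcases hr with h | h <;> linarith
  cases a <;> cases b <;> cases c <;> simp only [dist] <;> (try split_ifs) <;>
    first | linarith | (exfalso; simp_all)

end StarNode

namespace StarShape

/-- The distance from the core to the tips in the `n`-th piece. -/
noncomputable def tipDist (D : StarShape) (n : ℕ) : ℝ := by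
  classical exact if D.inner n then 1 else min (D.far n) 2

variable (D : StarShape)

lemma tipDist_of_inner {n : ℕ} (h : D.inner n) : D.tipDist n = 1 := by simp [tipDist, h]

lemma tipDist_of_not_inner {n : ℕ} (h : ¬ D.inner n) : D.tipDist n = min (D.far n) 2 := by
  simp [tipDist, h]

lemma tipDist_cases (n : ℕ) :
    D.tipDist n = min (D.far n) 2 ∨ D.tipDist n = 1 ∧ D.far n ≤ 2 := by
  by_cases h : D.inner n
  · exact Or.inr ⟨D.tipDist_of_inner h, D.far_le_two n h⟩
  · exact Or.inl (D.tipDist_of_not_inner h)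

lemma one_lt_min (n : ℕ) : 1 < min (D.far n) 2 := lt_min (D.one_lt_far n) one_lt_two

lemma one_le_tipDist (n : ℕ) : 1 ≤ D.tipDist n := by
  have := D.one_lt_min n
  rcases D.tipDist_cases n with h | h <;> linarith

lemma tipDist_le_min (n : ℕ) : D.tipDist n ≤ min (D.far n) 2 := by
  have := D.one_lt_min n
  rcases D.tipDist_cases n with h | h <;> linarith

/-- The disjoint union of all pieces. -/
structure Point where
  idx : ℕ
  node : StarNode (Fin (D.num idx))

namespace Point

variable {D}

instance : Nonempty D.Point := ⟨⟨0, .core⟩⟩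

lemma raw_injective :
    Function.Injective fun z : D.Point => (z.idx, z.node.map Fin.val) := by
  rintro ⟨m, a⟩ ⟨n, b⟩ h
  simp only [Prod.mk.injEq] at h
  obtain ⟨rfl, h⟩ := h
  rw [StarNode.map_injective Fin.val_injective h]

instance : Countable D.Point := raw_injective.countable

/-- Labels are sent to `ℕ` so that nodes of the two dependent types can be compared without
transport. The distance between pieces exceeds their diameter bound `3` and makes large balls
initial unions of pieces. -/
noncomputable instance : Dist D.Point :=
  ⟨fun x y => if x.idx = y.idx then
    StarNode.dist (D.tipDist x.idx) (D.far x.idx) (x.node.map Fin.val) (y.node.map Fin.val)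
    else 3 + max (x.idx : ℝ) y.idx⟩

lemma dist_mk (n : ℕ) (a b : StarNode (Fin (D.num n))) :
    dist (⟨n, a⟩ : D.Point) ⟨n, b⟩ = StarNode.dist (D.tipDist n) (D.far n) a b := by
  simp only [dist, if_true]
  exact StarNode.dist_map Fin.val_injective ..

lemma dist_of_ne {x y : D.Point} (h : x.idx ≠ y.idx) : dist x y = 3 + max (x.idx : ℝ) y.idx :=
  if_neg h

lemma dist_le_three {x y : D.Point} (h : x.idx = y.idx) : dist x y ≤ 3 := by
  obtain ⟨n, a⟩ := x
  obtain ⟨m, b⟩ := y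
  obtain rfl : n = m := h
  rw [dist_mk]
  exact StarNode.dist_le_three ((D.tipDist_le_min n).trans (min_le_right _ _))
    (D.far_le_three n) a b

lemma one_le_dist {x y : D.Point} (h : x ≠ y) : 1 ≤ dist x y := by
  by_cases hxy : x.idx = y.idx
  · obtain ⟨n, a⟩ := x
    obtain ⟨m, b⟩ := y
    obtain rfl : n = m := hxy
    rw [dist_mk]
    exact StarNode.one_le_dist (D.one_le_tipDist n) (D.one_lt_far n) fun hab => h (by rw [hab])
  · rw [dist_of_ne hxy]
    have : (0 : ℝ) ≤ max (x.idx : ℝ) y.idx := le_max_of_le_left (by positivity)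
    linarith

lemma dist_self' (x : D.Point) : dist x x = 0 := by
  obtain ⟨n, a⟩ := x
  rw [dist_mk, StarNode.dist_self]

lemma dist_comm' (x y : D.Point) : dist x y = dist y x := by
  by_cases hxy : x.idx = y.idx
  · obtain ⟨n, a⟩ := x
    obtain ⟨m, b⟩ := y
    obtain rfl : n = m := hxy
    rw [dist_mk, dist_mk, StarNode.dist_comm]
  · rw [dist_of_ne hxy, dist_of_ne (Ne.symm hxy), max_comm]

lemma dist_triangle' (x y z : D.Point) : dist x z ≤ dist x y + dist y z := by
  have hnn : ∀ u v : D.Point, 0 ≤ dist u v := fun u v => by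
    by_cases h : u = v
    · rw [h, dist_self']
    · exact zero_le_one.trans (one_le_dist h)
  by_cases hxy : x.idx = y.idx <;> by_cases hyz : y.idx = z.idx
  · obtain ⟨n, a⟩ := x
    obtain ⟨m, b⟩ := y
    obtain ⟨l, c⟩ := z
    obtain rfl : n = m := hxy
    obtain rfl : n = l := hyz
    simp only [dist_mk]
    exact StarNode.dist_triangle (D.one_lt_far n) (D.far_le_three n) (D.tipDist_cases n) a b c
  · rw [dist_of_ne hyz, dist_of_ne (hxy ▸ hyz), hxy]
    linarith [hnn x y]
  · rw [dist_of_ne hxy, dist_of_ne (hyz ▸ hxy), ← hyz]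
    linarith [hnn y z]
  · rw [dist_of_ne hxy, dist_of_ne hyz]
    have h0 : ∀ n : ℕ, (0 : ℝ) ≤ n := fun n => n.cast_nonneg
    have h1 := le_max_left (x.idx : ℝ) y.idx
    have h2 := le_max_right (y.idx : ℝ) z.idx
    have h3 := h0 x.idx
    have h4 := h0 z.idx
    by_cases hxz : x.idx = z.idx
    · linarith [dist_le_three hxz]
    · rw [dist_of_ne hxz]
      have : max (x.idx : ℝ) z.idx ≤ x.idx + z.idx := max_le (by linarith) (by linarith)
      linarith

noncomputable instance : MetricSpace D.Point where
  dist_self := dist_self'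
  dist_comm := dist_comm'
  dist_triangle := dist_triangle'
  eq_of_dist_eq_zero := fun {x y} h => by
    by_contra hne
    linarith [one_le_dist hne]

instance : DiscreteTopology D.Point :=
  .of_forall_le_dist one_pos fun _ _ h => one_le_dist h

instance : MeasurableSpace D.Point := ⊤

instance : DiscreteMeasurableSpace D.Point := ⟨fun _ => trivial⟩

instance : BorelSpace D.Point := ⟨borel_eq_top_of_discrete.symm⟩

end Point

/-! ### Masses of the pieces -/

/-- The `n`-th piece. -/
def piece (n : ℕ) : Set D.Point := {z | z.idx = n}

/-- The core and all midpoints of the `n`-th piece. -/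
def hub (n : ℕ) : Set D.Point := {z | z.idx = n ∧ ∀ i, z.node ≠ .tip i}

/-- The tips of the `n`-th piece. -/
def tips (n : ℕ) : Set D.Point := {z | z.idx = n ∧ ∃ i, z.node = .tip i}

/-- The mass of a point. -/
noncomputable def mass (z : D.Point) : ℝ≥0∞ :=
  match z.node with
  | .core => 1
  | .mid _ => (D.num z.idx : ℝ≥0∞)⁻¹
  | .tip _ => 2 ^ z.idx

/-- The measure given by the point masses. -/
noncomputable def measure : Measure D.Point := Measure.sum fun z => D.mass z • Measure.dirac z

lemma measure_singleton (z : D.Point) : D.measure {z} = D.mass z := by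
  rw [measure, Measure.sum_apply _ (measurableSet_singleton z), tsum_eq_single z]
  · simp
  · intro y hy
    simp [hy]

lemma mass_pos (z : D.Point) : 0 < D.mass z := by
  obtain ⟨n, a⟩ := z
  cases a
  · exact one_pos
  · exact ENNReal.inv_pos.2 (ENNReal.natCast_ne_top _)
  · exact ENNReal.pow_pos (by simp) _

lemma measure_pos {S : Set D.Point} {z : D.Point} (hz : z ∈ S) : 0 < D.measure S :=
  (D.measure_singleton z ▸ D.mass_pos z).trans_le (measure_mono (Set.singleton_subset_iff.2 hz))

lemma measure_core (n : ℕ) : D.measure {⟨n, .core⟩} = 1 := D.measure_singleton _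

lemma measure_tip (n : ℕ) (i : Fin (D.num n)) : D.measure {⟨n, .tip i⟩} = 2 ^ n :=
  D.measure_singleton _

lemma measure_mid (n : ℕ) (i : Fin (D.num n)) :
    D.measure {⟨n, .mid i⟩} = (D.num n : ℝ≥0∞)⁻¹ := D.measure_singleton _

lemma measure_hub_le (n : ℕ) : D.measure (D.hub n) ≤ 2 := by
  have hsub : D.hub n ⊆ {⟨n, .core⟩} ∪ ⋃ i : Fin (D.num n), {⟨n, .mid i⟩} := by
    rintro ⟨m, a⟩ ⟨h, ha⟩
    obtain rfl : m = n := h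
    cases a <;> simp_all
  refine (measure_mono hsub).trans ((measure_union_le _ _).trans ?_)
  rw [measure_core, ← one_add_one_eq_two]
  gcongr
  refine (measure_iUnion_le _).trans ?_
  simp only [measure_mid, tsum_fintype, Finset.sum_const, Finset.card_univ, Fintype.card_fin,
    nsmul_eq_mul]
  exact ENNReal.mul_inv_le_one _

lemma measure_tips (n : ℕ) : D.measure (D.tips n) = D.num n * 2 ^ n := by
  have heq : D.tips n = ⋃ i : Fin (D.num n), {⟨n, .tip i⟩} := by
    ext ⟨m, a⟩
    simp only [tips, Set.mem_ofPred_eq, Set.mem_iUnion, Set.mem_singleton_iff, Point.mk.injEq]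
    constructor
    · rintro ⟨rfl, i, hi⟩
      exact ⟨i, rfl, heq_of_eq hi⟩
    · rintro ⟨i, rfl, hi⟩
      exact ⟨rfl, i, eq_of_heq hi⟩
  rw [heq, measure_iUnion _ fun i => measurableSet_singleton _]
  · simp [measure_tip, tsum_fintype]
  · intro i j hij
    simp [Function.onFun, hij]

lemma piece_subset (n : ℕ) : D.piece n ⊆ D.hub n ∪ D.tips n := by
  rintro ⟨m, a⟩ h
  obtain rfl : m = n := h
  cases a <;> simp [hub, tips]

lemma measure_piece_le (n : ℕ) : D.measure (D.piece n) ≤ 2 + D.num n * 2 ^ n :=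
  (measure_mono (D.piece_subset n)).trans <| (measure_union_le _ _).trans <| by
    rw [measure_tips]
    gcongr
    exact D.measure_hub_le n

lemma measure_ball_lt_top (x : D.Point) (s : ℝ) : D.measure (Metric.ball x s) < ∞ := by
  have hsub : Metric.ball x s ⊆ ⋃ n ∈ Finset.range (max x.idx ⌈s⌉₊ + 1), D.piece n := by
    intro y hy
    simp only [Set.mem_iUnion, Finset.mem_range, exists_prop, Nat.lt_succ_iff]
    refine ⟨y.idx, ?_, rfl⟩
    by_cases h : y.idx = x.idx
    · rw [h]
      exact le_max_left _ _
    · rw [Metric.mem_ball, Point.dist_of_ne h] at hy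
      refine le_max_of_le_right ?_
      have h1 := le_max_left (y.idx : ℝ) x.idx
      have h2 := Nat.le_ceil s
      exact_mod_cast (by linarith : (y.idx : ℝ) ≤ ⌈s⌉₊)
  refine (measure_mono hsub).trans_lt ((measure_biUnion_finset_le _ _).trans_lt ?_)
  refine ENNReal.sum_lt_top.2 fun n _ => (D.measure_piece_le n).trans_lt ?_
  refine ENNReal.add_lt_top.2 ⟨by simp, ENNReal.mul_lt_top (by simp) ?_⟩
  exact ENNReal.pow_lt_top (by simp)

end StarShape

/-! ### Hölder's inequality and summation of local bounds -/

section Averages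

variable {α : Type*} [MeasurableSpace α] {μ : Measure α}

/-- The sets in a nested family satisfying a uniform bound have a union satisfying it. -/
lemma mul_measure_biUnion_le_of_monotone {V : ℕ → Set α} (hV : Monotone V) {K : Set ℕ}
    {a b : ℝ≥0∞} (h : ∀ k ∈ K, a * μ (V k) ≤ b) : a * μ (⋃ k ∈ K, V k) ≤ b := by
  rw [measure_biUnion_eq_iSup K.to_countable]
  · simp only [ENNReal.mul_iSup]
    exact iSup₂_le h
  · intro i hi j hj
    rcases le_total i j with hij | hij
    · exact ⟨j, hj, hV hij, le_rfl⟩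
    · exact ⟨i, hi, le_rfl, hV hij⟩

variable [DiscreteMeasurableSpace α]

lemma setLIntegral_rpow_le (F : α → ℝ≥0∞) (B : Set α) {q : ℝ} (hq : 1 ≤ q) :
    (∫⁻ y in B, F y ∂μ) ^ q ≤ μ B ^ (q - 1) * ∫⁻ y in B, F y ^ q ∂μ := by
  have hq0 : 0 < q := one_pos.trans_le hq
  have hF : AEStronglyMeasurable F (μ.restrict B) :=
    (Measurable.of_discrete (f := F)).aestronglyMeasurable
  have h := eLpNorm'_le_eLpNorm'_mul_rpow_measure_univ one_pos hq hF
  simp only [eLpNorm'_eq_lintegral_enorm, enorm_eq_self, ENNReal.rpow_one, one_div, inv_one,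
    Measure.restrict_apply_univ] at h
  have h' := ENNReal.rpow_le_rpow h hq0.le
  rwa [ENNReal.mul_rpow_of_nonneg _ _ hq0.le, ← ENNReal.rpow_mul, ← ENNReal.rpow_mul,
    inv_mul_cancel₀ hq0.ne', ENNReal.rpow_one, sub_mul, inv_mul_cancel₀ hq0.ne', one_mul,
    mul_comm] at h'

/-- Hölder's inequality on `B` costs `μ B ^ (q - 1) ≤ μ B' ^ (q - 1)`, which cancels against the
normalization by `μ B'`. -/
lemma rpow_mul_measure_le_of_lt_average {F : α → ℝ≥0∞} {B B' : Set α} (hB : B ⊆ B')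
    (h0 : μ B' ≠ 0) (htop : μ B' ≠ ∞) {q : ℝ} (hq : 1 ≤ q) {t : ℝ≥0∞}
    (ht : t < (∫⁻ y in B, F y ∂μ) / μ B') :
    t ^ q * μ B' ≤ ∫⁻ y in B, F y ^ q ∂μ := by
  have h1 : t * μ B' ≤ ∫⁻ y in B, F y ∂μ :=
    (ENNReal.le_div_iff_mul_le (Or.inl h0) (Or.inl htop)).1 ht.le
  have hq0 : 0 ≤ q := zero_le_one.trans hq
  have h2 : (t ^ q * μ B') * μ B' ^ (q - 1) ≤ (∫⁻ y in B, F y ^ q ∂μ) * μ B' ^ (q - 1) :=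
    calc (t ^ q * μ B') * μ B' ^ (q - 1) = (t * μ B') ^ q := by
          rw [ENNReal.mul_rpow_of_nonneg _ _ hq0, mul_assoc]
          congr 1
          nth_rw 1 [← ENNReal.rpow_one (μ B')]
          rw [← ENNReal.rpow_add _ _ h0 htop]
          congr 1
          ring
      _ ≤ (∫⁻ y in B, F y ∂μ) ^ q := ENNReal.rpow_le_rpow h1 hq0
      _ ≤ μ B ^ (q - 1) * ∫⁻ y in B, F y ^ q ∂μ := setLIntegral_rpow_le F B hq
      _ ≤ μ B' ^ (q - 1) * ∫⁻ y in B, F y ^ q ∂μ := by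
          gcongr
      _ = _ := mul_comm _ _
  refine (ENNReal.mul_le_mul_iff_left ?_ ?_).1 h2
  · exact (ENNReal.rpow_pos (pos_iff_ne_zero.2 h0) htop).ne'
  · exact ENNReal.rpow_ne_top_of_nonneg (by linarith) htop

/-- Local bounds on the fibres of a map with countably many values add up. -/
lemma mul_measure_le_lintegral_of_fibers {ι : Type*} [Countable ι] (π : α → ι) {E : Set α}
    {a : ℝ≥0∞} {G : α → ℝ≥0∞}
    (h : ∀ x ∈ E, a * μ (E ∩ π ⁻¹' {π x}) ≤ ∫⁻ y in π ⁻¹' {π x}, G y ∂μ) :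
    a * μ E ≤ ∫⁻ y, G y ∂μ := by
  have hE : μ E ≤ ∑' j, μ (E ∩ π ⁻¹' {j}) := by
    refine le_trans (measure_mono ?_) (measure_iUnion_le _)
    exact fun x hx => Set.mem_iUnion.2 ⟨π x, hx, rfl⟩
  have huniv : ⋃ j, π ⁻¹' {j} = Set.univ := by
    ext x
    simp
  calc a * μ E ≤ a * ∑' j, μ (E ∩ π ⁻¹' {j}) := by gcongr
    _ = ∑' j, a * μ (E ∩ π ⁻¹' {j}) := ENNReal.tsum_mul_left.symm
    _ ≤ ∑' j, ∫⁻ y in π ⁻¹' {j}, G y ∂μ := by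
        refine ENNReal.tsum_le_tsum fun j => ?_
        rcases (E ∩ π ⁻¹' {j}).eq_empty_or_nonempty with hj | ⟨x, hx, hxj⟩
        · simp [hj]
        · obtain rfl : π x = j := hxj
          exact h x hx
    _ = ∫⁻ y, G y ∂μ := by
        rw [← lintegral_iUnion (fun _ => MeasurableSet.of_discrete), huniv,
          Measure.restrict_univ]
        intro i j hij
        exact Disjoint.preimage π (Set.disjoint_singleton.2 hij)

end Averages

/-! ### Weak type and distribution functions -/

section WeakType

lemma ball_subset_ball_mul {Y : Type*} [MetricSpace Y] {κ : ℝ} (hκ : 1 ≤ κ) (c : Y) {s : ℝ} (hs : 0 < s) :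
    Metric.ball c s ⊆ Metric.ball c (κ * s) :=
  Metric.ball_subset_ball (le_mul_of_one_le_left hs.le hκ)

variable {X : Type*} [MeasurableSpace X] {μ : Measure X}

lemma isWeakType_of_distribution_le {p : ℝ≥0∞} (hp : 1 ≤ p) (hptop : p ≠ ∞)
    {T : (X → ℂ) → X → ℝ≥0∞} {K : ℝ≥0∞} (hK : K ≠ ∞)
    (h : ∀ f : X → ℂ, ∀ t : ℝ≥0, 0 < t → (t : ℝ≥0∞) ^ p.toReal * μ {x | (t : ℝ≥0∞) < T f x} ≤
      K * ∫⁻ y, ‖f y‖ₑ ^ p.toReal ∂μ) : IsWeakType μ p T := by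
  have hp0 : p ≠ 0 := (one_pos.trans_le hp).ne'
  have hq : 0 < p.toReal := ENNReal.toReal_pos hp0 hptop
  have hKq : K ^ (1 / p.toReal) ≠ ∞ := ENNReal.rpow_ne_top_of_nonneg (by positivity) hK
  refine ⟨(K ^ (1 / p.toReal)).toNNReal, fun f _ => ?_⟩
  rw [ENNReal.coe_toNNReal hKq, weakLpNorm, if_neg hptop,
    eLpNorm_eq_lintegral_rpow_enorm_toReal hp0 hptop]
  refine iSup₂_le fun t ht => ?_
  have := ENNReal.rpow_le_rpow (h f t ht) (by positivity : 0 ≤ 1 / p.toReal)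
  rwa [ENNReal.mul_rpow_of_nonneg _ _ (by positivity), ← ENNReal.rpow_mul,
    mul_one_div_cancel hq.ne', ENNReal.rpow_one,
    ENNReal.mul_rpow_of_nonneg _ _ (by positivity)] at this

lemma distribution_le_of_isWeakType {p : ℝ≥0∞} (hp : 1 ≤ p) (hptop : p ≠ ∞)
    {T : (X → ℂ) → X → ℝ≥0∞} (h : IsWeakType μ p T) :
    ∃ C : ℝ≥0, ∀ f : X → ℂ, MemLp f p μ → ∀ t : ℝ≥0, 0 < t →
      (t : ℝ≥0∞) ^ p.toReal * μ {x | (t : ℝ≥0∞) < T f x} ≤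
        (C * eLpNorm f p μ) ^ p.toReal := by
  have hp0 : p ≠ 0 := (one_pos.trans_le hp).ne'
  have hq : 0 < p.toReal := ENNReal.toReal_pos hp0 hptop
  obtain ⟨C, hC⟩ := h
  refine ⟨C, fun f hf t ht => ?_⟩
  have h1 := hC f hf
  rw [weakLpNorm, if_neg hptop] at h1
  have h2 := ENNReal.rpow_le_rpow ((le_iSup₂ (f := fun (t : ℝ≥0) (_ : 0 < t) =>
    (t : ℝ≥0∞) * μ {x | (t : ℝ≥0∞) < T f x} ^ (1 / p.toReal)) t ht).trans h1) hq.le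
  rwa [ENNReal.mul_rpow_of_nonneg _ _ hq.le, ← ENNReal.rpow_mul, one_div_mul_cancel hq.ne',
    ENNReal.rpow_one] at h2

lemma setLIntegral_div_le_eLpNorm_top {B B' : Set X} (hB : B ⊆ B') (f : X → ℂ) :
    (∫⁻ y in B, ‖f y‖ₑ ∂μ) / μ B' ≤ eLpNorm f ∞ μ := by
  refine ENNReal.div_le_of_le_mul ?_
  calc ∫⁻ y in B, ‖f y‖ₑ ∂μ ≤ ∫⁻ _ in B, eLpNorm f ∞ μ ∂μ :=
        lintegral_mono_ae (ae_restrict_of_ae (by simpa using enorm_ae_le_eLpNormEssSup f μ))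
    _ ≤ eLpNorm f ∞ μ * μ B' := by
        rw [setLIntegral_const]
        gcongr

lemma isWeakType_top_of_le {T : (X → ℂ) → X → ℝ≥0∞} (h : ∀ f x, T f x ≤ eLpNorm f ∞ μ) :
    IsWeakType μ ∞ T := by
  refine ⟨1, fun f _ => ?_⟩
  rw [weakLpNorm, if_pos rfl, ENNReal.coe_one, one_mul]
  exact essSup_le_of_ae_le _ (Filter.Eventually.of_forall (h f))

variable {Y : Type*} [MetricSpace Y] [MeasurableSpace Y] {ν : Measure Y} {κ : ℝ}

lemma isWeakType_top_centeredMaximal (hκ : 1 ≤ κ) : IsWeakType ν ∞ (centeredMaximal ν κ) :=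
  isWeakType_top_of_le fun f x => iSup₂_le fun _ hs =>
    setLIntegral_div_le_eLpNorm_top (ball_subset_ball_mul hκ x hs) f

lemma isWeakType_top_noncenteredMaximal (hκ : 1 ≤ κ) :
    IsWeakType ν ∞ (noncenteredMaximal ν κ) :=
  isWeakType_top_of_le fun f _ => iSup_le fun c => iSup₂_le fun _ hs => iSup_le fun _ =>
    setLIntegral_div_le_eLpNorm_top (ball_subset_ball_mul hκ c hs) f

end WeakType

/-! ### Shapes of balls and the upper bound -/

namespace StarShape

variable (D : StarShape)

/-- The union of the first `k` pieces. -/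
def initial (k : ℕ) : Set D.Point := {z | z.idx < k}

lemma initial_mono : Monotone D.initial := fun _ _ hij _ hz => lt_of_lt_of_le hz hij

variable {D}

/-- The piece and the branch to which a point belongs. -/
def Point.label (z : D.Point) : ℕ × Option ℕ := (z.idx, z.node.branch.map Fin.val)

lemma mem_ball_mk {n : ℕ} {a b : StarNode (Fin (D.num n))} {s : ℝ} :
    (⟨n, b⟩ : D.Point) ∈ Metric.ball (⟨n, a⟩ : D.Point) s ↔
      StarNode.dist (D.tipDist n) (D.far n) b a < s := by
  rw [Metric.mem_ball, Point.dist_mk]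

lemma ball_eq_initial {c : D.Point} {s : ℝ} (hs : 3 + (c.idx : ℝ) < s) :
    Metric.ball c s = D.initial ⌈s - 3⌉₊ := by
  have hc : c.idx < ⌈s - 3⌉₊ := Nat.lt_ceil.2 (by linarith)
  refine Set.ext fun z => ?_
  change dist z c < s ↔ z.idx < _
  by_cases h : z.idx = c.idx
  · refine iff_of_true ?_ (h ▸ hc)
    have : (0 : ℝ) ≤ c.idx := Nat.cast_nonneg _
    linarith [Point.dist_le_three h]
  · rw [Point.dist_of_ne h, Nat.lt_ceil]
    constructor
    · intro h'
      linarith [le_max_left (z.idx : ℝ) c.idx]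
    · intro h'
      have := max_lt h' (show (c.idx : ℝ) < s - 3 by linarith)
      linarith

lemma ball_subset_piece {c : D.Point} {s : ℝ} (hs : s ≤ 3 + (c.idx : ℝ)) :
    Metric.ball c s ⊆ D.piece c.idx := by
  intro z hz
  by_contra h
  rw [Metric.mem_ball, Point.dist_of_ne h] at hz
  linarith [le_max_right (z.idx : ℝ) c.idx]

lemma ball_eq_singleton {c : D.Point} {s : ℝ} (hs : 0 < s) (hs1 : s ≤ 1) :
    Metric.ball c s = {c} := by
  ext z
  constructor
  · intro hz
    by_contra h
    exact absurd (Point.one_le_dist h) (not_le.2 (lt_of_lt_of_le hz hs1))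
  · rintro rfl
    exact Metric.mem_ball_self hs

lemma piece_subset_ball {n : ℕ} {a : StarNode (Fin (D.num n))} {s : ℝ}
    (h : ∀ b, StarNode.dist (D.tipDist n) (D.far n) b a < s) :
    D.piece n ⊆ Metric.ball (⟨n, a⟩ : D.Point) s := by
  rintro ⟨m, b⟩ hz
  obtain rfl : m = n := hz
  exact mem_ball_mk.2 (h b)

/-- The possible shapes of a ball `B` containing `x`, relative to its dilation. -/
lemma ball_classification {κ : ℝ} (hκ : 1 ≤ κ) {c x : D.Point} {s : ℝ} (hs : 0 < s)
    (hx : x ∈ Metric.ball c s) :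
    (∃ k, x.idx < k ∧ Metric.ball c s = D.initial k) ∨
    (Metric.ball c s = {x}) ∨
    (Metric.ball c s = Point.label ⁻¹' {x.label}) ∨
    (Metric.ball c s ⊆ D.piece x.idx ∧
      D.measure (D.piece x.idx) ≤ 2 * D.measure (Metric.ball c (κ * s))) ∨
    (Metric.ball c s ⊆ D.piece x.idx ∧ x ∈ D.hub x.idx ∧
      (⟨x.idx, .core⟩ : D.Point) ∈ Metric.ball c s) ∨
    (Metric.ball c s ⊆ D.hub x.idx ∪ {x} ∧ x ∈ D.tips x.idx ∧ κ < D.far x.idx ∧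
      (c = x → D.inner x.idx)) := by
  rcases lt_or_ge (3 + (c.idx : ℝ)) s with hs3 | hs3
  · have h2 := ball_eq_initial hs3
    rw [h2] at hx ⊢
    exact Or.inl ⟨_, hx, rfl⟩
  right
  rcases le_or_gt s 1 with hs1 | hs1
  · rw [ball_eq_singleton hs hs1] at hx ⊢
    left
    rw [Set.mem_singleton_iff.1 hx]
  right
  have hsub := ball_subset_piece hs3
  obtain ⟨n, b⟩ := x
  obtain ⟨m, a⟩ := c
  obtain rfl : n = m := hsub hx
  have hsκ : s ≤ κ * s := le_mul_of_one_le_left hs.le hκ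
  have hcore_case (hcore : (⟨n, .core⟩ : D.Point) ∈ Metric.ball (⟨n, a⟩ : D.Point) s)
      (hb : ∀ i, b ≠ .tip i) := And.intro hsub
        (And.intro (show (⟨n, b⟩ : D.Point) ∈ D.hub n from ⟨rfl, hb⟩) hcore)
  have hfull (h : ∀ b', StarNode.dist (D.tipDist n) (D.far n) b' a < κ * s) :
      D.measure (D.piece n) ≤ 2 * D.measure (Metric.ball (⟨n, a⟩ : D.Point) (κ * s)) :=
    (measure_mono (piece_subset_ball h)).trans (le_mul_of_one_le_left zero_le one_le_two)
  have hσ := D.one_lt_min n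
  have hστ : min (D.far n) 2 ≤ D.far n := min_le_left _ _
  have hρσ := D.tipDist_le_min n
  have hsmall (hκs : κ * s ≤ D.far n) : κ < D.far n :=
    (lt_mul_of_one_lt_right (by linarith) hs1).trans_le hκs
  have hx' := mem_ball_mk.1 hx
  cases a with
  | core =>
    cases b with
    | core => exact Or.inr (Or.inr (Or.inl (hcore_case (Metric.mem_ball_self hs) (by simp))))
    | mid i => exact Or.inr (Or.inr (Or.inl (hcore_case (Metric.mem_ball_self hs) (by simp))))
    | tip i =>
      refine Or.inr (Or.inl ⟨hsub, hfull fun b' => ?_⟩)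
      simp only [StarNode.dist] at hx'
      cases b' <;> simp only [StarNode.dist] <;> linarith
  | mid j =>
    have hcore : (⟨n, .core⟩ : D.Point) ∈ Metric.ball (⟨n, .mid j⟩ : D.Point) s := by
      rw [mem_ball_mk]
      simpa only [StarNode.dist] using hs1
    cases b with
    | core => exact Or.inr (Or.inr (Or.inl (hcore_case hcore (by simp))))
    | mid i => exact Or.inr (Or.inr (Or.inl (hcore_case hcore (by simp))))
    | tip i =>
      -- Either the dilation swallows the whole piece, or `s ≤ κ * s ≤ far n` keeps out every tip
      -- but the one on the branch of the center.
      rcases lt_or_ge (D.far n) (κ * s) with hκs | hκs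
      · refine Or.inr (Or.inl ⟨hsub, hfull fun b' => ?_⟩)
        cases b' <;> simp only [StarNode.dist] <;> (try split_ifs) <;> linarith
      · have htip : ∀ k, (⟨n, .tip k⟩ : D.Point) ∈ Metric.ball (⟨n, .mid j⟩ : D.Point) s →
            k = j := by
          intro k hk
          by_contra hne
          simp only [mem_ball_mk, StarNode.dist, if_neg hne] at hk
          linarith
        refine Or.inr (Or.inr (Or.inr ⟨?_, ⟨rfl, i, rfl⟩, hsmall hκs, by simp⟩))
        rintro ⟨m, b'⟩ hz
        obtain rfl : m = n := hsub hz
        cases b' with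
        | core => exact Or.inl ⟨rfl, by simp⟩
        | mid k => exact Or.inl ⟨rfl, by simp⟩
        | tip k => exact Or.inr (by rw [htip k hz, htip i hx]; rfl)
  | tip j =>
    rcases lt_or_ge (D.tipDist n) s with hρ | hρ
    · have hcore : (⟨n, .core⟩ : D.Point) ∈ Metric.ball (⟨n, .tip j⟩ : D.Point) s := by
        rw [mem_ball_mk]
        simpa only [StarNode.dist] using hρ
      cases b with
      | core => exact Or.inr (Or.inr (Or.inl (hcore_case hcore (by simp))))
      | mid i => exact Or.inr (Or.inr (Or.inl (hcore_case hcore (by simp))))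
      | tip i =>
        by_cases hin : D.inner n
        · have hσ' : min (D.far n) 2 = D.far n := min_eq_left (D.far_le_two n hin)
          rcases lt_or_ge (D.far n) (κ * s) with hκs | hκs
          · refine Or.inr (Or.inl ⟨hsub, hfull fun b' => ?_⟩)
            cases b' <;> simp only [StarNode.dist] <;> (try split_ifs) <;> linarith
          · have htip : ∀ k, (⟨n, .tip k⟩ : D.Point) ∈ Metric.ball (⟨n, .tip j⟩ : D.Point) s →
                k = j := by
              intro k hk
              by_contra hne
              simp only [mem_ball_mk, StarNode.dist, if_neg hne] at hk
              linarith
            refine Or.inr (Or.inr (Or.inr ⟨?_, ⟨rfl, i, rfl⟩, hsmall hκs, fun _ => hin⟩))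
            rintro ⟨m, b'⟩ hz
            obtain rfl : m = n := hsub hz
            cases b' with
            | core => exact Or.inl ⟨rfl, by simp⟩
            | mid k => exact Or.inl ⟨rfl, by simp⟩
            | tip k => exact Or.inr (by rw [htip k hz, htip i hx]; rfl)
        -- Reaching the core takes a radius above `min (far n) 2`, the distance between tips, so all
        -- tips are included. Core and tips carry at least half of the mass of the piece.
        · refine Or.inr (Or.inl ⟨hsub, ?_⟩)
          rw [D.tipDist_of_not_inner hin] at hρ
          have hsub' : {⟨n, .core⟩} ∪ D.tips n ⊆
              Metric.ball (⟨n, .tip j⟩ : D.Point) (κ * s) := by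
            refine Set.union_subset (Set.singleton_subset_iff.2
              (Metric.ball_subset_ball hsκ hcore)) ?_
            rintro ⟨m, b'⟩ ⟨h, k, hk⟩
            obtain rfl : m = n := h
            change Fin (D.num m) at k
            obtain rfl : b' = .tip k := hk
            rw [mem_ball_mk]
            simp only [StarNode.dist]
            split_ifs <;> linarith
          have hdisj : Disjoint {⟨n, .core⟩} (D.tips n) := by
            rw [Set.disjoint_singleton_left]
            rintro ⟨-, k, hk⟩
            cases hk
          have hμ := measure_mono (μ := D.measure) hsub'
          rw [measure_union hdisj MeasurableSet.of_discrete, measure_core, measure_tips] at hμ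
          calc D.measure (D.piece n) ≤ 2 + D.num n * 2 ^ n := D.measure_piece_le n
            _ ≤ 2 * 1 + 2 * (D.num n * 2 ^ n) := by
                rw [mul_one]
                exact add_le_add_right (le_mul_of_one_le_left zero_le one_le_two) _
            _ = 2 * (1 + D.num n * 2 ^ n) := (mul_add _ _ _).symm
            _ ≤ _ := by gcongr
    -- With `1 < s ≤ tipDist n`, the ball is the branch consisting of one midpoint and its tip.
    · left
      have hin : ¬ D.inner n := fun hin => by
        rw [D.tipDist_of_inner hin] at hρ
        linarith
      have key : ∀ b' : StarNode (Fin (D.num n)),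
          (⟨n, b'⟩ : D.Point) ∈ Metric.ball (⟨n, .tip j⟩ : D.Point) s ↔
            b'.branch = some j := by
        intro b'
        rw [mem_ball_mk]
        cases b' with
        | core => simpa [StarNode.dist, StarNode.branch] using hρ
        | mid k =>
          simp only [StarNode.dist, StarNode.branch, Option.some.injEq]
          split_ifs with h
          · exact iff_of_true hs1 h
          · exact iff_of_false (by linarith) h
        | tip k =>
          simp only [StarNode.dist, StarNode.branch, Option.some.injEq]
          split_ifs with h
          · exact iff_of_true hs h
          · exact iff_of_false (by linarith) h
      have hb := (key b).1 hx
      ext ⟨m, b'⟩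
      simp only [Set.mem_preimage, Set.mem_singleton_iff, Point.label, Prod.mk.injEq, hb]
      constructor
      · intro hz
        obtain rfl : m = n := hsub hz
        exact ⟨rfl, by rw [(key b').1 hz]⟩
      · rintro ⟨rfl, h⟩
        refine (key b').2 (Option.map_injective Fin.val_injective h)

/-- A bound on the distribution function of a maximal operator. The set `S` contains the indices of
the pieces on which the operator can be large. -/
lemma rpow_mul_measure_le {κ q : ℝ} (hκ : 1 ≤ κ) (hq : 1 ≤ q) {S : Set ℕ} {K : ℝ≥0∞}
    (hS : ∀ n ∈ S, D.measure (D.piece n) ≤ K * (2 ^ n) ^ q) (F : D.Point → ℝ≥0∞) {t : ℝ≥0∞}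
    {E : Set D.Point}
    (hE : ∀ x ∈ E, ∃ c s, 0 < s ∧ x ∈ Metric.ball c s ∧
      t < (∫⁻ y in Metric.ball c s, F y ∂D.measure) / D.measure (Metric.ball c (κ * s)) ∧
      (κ < D.far x.idx → (c = x → D.inner x.idx) → x.idx ∈ S)) :
    t ^ q * D.measure E ≤
      (1 + 2 ^ q + 1 + 2 + (2 + K * 4 ^ q)) * ∫⁻ y, F y ^ q ∂D.measure := by
  have hq0 : 0 ≤ q := zero_le_one.trans hq
  -- The level set is covered according to the shape of the ball. `E₁` is a union of nested sets;
  -- the bounds defining `E₂` to `E₅` live on disjoint points, branches or pieces and can be summed.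
  set G : Set ℕ := {k | t ^ q * D.measure (D.initial k) ≤ ∫⁻ y, F y ^ q ∂D.measure}
  set E₁ : Set D.Point := ⋃ k ∈ G, D.initial k
  set E₂ : Set D.Point :=
    {x | t ^ q * D.measure {x} ≤ ∫⁻ y in {x}, 2 ^ q * F y ^ q ∂D.measure}
  set E₃ : Set D.Point := {x | t ^ q * D.measure (Point.label ⁻¹' {x.label}) ≤
    ∫⁻ y in Point.label ⁻¹' {x.label}, F y ^ q ∂D.measure}
  set E₄ : Set D.Point := {x | x ∈ D.hub x.idx ∧ t ^ q * D.measure (D.hub x.idx) ≤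
    ∫⁻ y in D.piece x.idx, 2 * F y ^ q ∂D.measure}
  set E₅ : Set D.Point := {x | t ^ q * D.measure (D.piece x.idx) ≤
    ∫⁻ y in D.piece x.idx, (2 + K * 4 ^ q) * F y ^ q ∂D.measure}
  have hmeas : Measurable fun y : D.Point => F y ^ q := Measurable.of_discrete
  have hsub : E ⊆ E₁ ∪ E₂ ∪ E₃ ∪ E₄ ∪ E₅ := by
    intro x hx
    obtain ⟨c, s, hs, hxB, ht, hxS⟩ := hE x hx
    have hBB := ball_subset_ball_mul hκ c hs
    have hpos := (D.measure_pos (Metric.mem_ball_self (x := c) (ε := κ * s) (by positivity))).ne'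
    have hfin := (D.measure_ball_lt_top c (κ * s)).ne
    have hbound := rpow_mul_measure_le_of_lt_average hBB hpos hfin hq ht
    have hbound' : t ^ q * D.measure (Metric.ball c s) ≤
        ∫⁻ y in Metric.ball c s, F y ^ q ∂D.measure :=
      le_trans (by gcongr) hbound
    rcases ball_classification hκ hs hxB with ⟨k, hk, hB⟩ | hB | hB | ⟨hB, hμ⟩ | ⟨hB, hhub, hcore⟩ |
      ⟨hB, ⟨-, i, hi⟩, hfar, hin⟩
    · rw [hB] at hbound'
      exact Or.inl (Or.inl (Or.inl (Or.inl (Set.mem_iUnion₂.2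
        ⟨k, hbound'.trans (setLIntegral_le_lintegral _ _), hk⟩))))
    · rw [hB] at hbound'
      refine Or.inl (Or.inl (Or.inl (Or.inr (hbound'.trans (lintegral_mono fun y => ?_)))))
      exact le_mul_of_one_le_left zero_le (ENNReal.one_le_rpow one_le_two (one_pos.trans_le hq))
    · rw [hB] at hbound'
      exact Or.inl (Or.inl (Or.inr hbound'))
    · refine Or.inr ?_
      calc t ^ q * D.measure (D.piece x.idx)
          ≤ t ^ q * (2 * D.measure (Metric.ball c (κ * s))) := by gcongr
        _ = 2 * (t ^ q * D.measure (Metric.ball c (κ * s))) := mul_left_comm _ _ _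
        _ ≤ 2 * ∫⁻ y in Metric.ball c s, F y ^ q ∂D.measure := by gcongr
        _ ≤ (2 + K * 4 ^ q) * ∫⁻ y in D.piece x.idx, F y ^ q ∂D.measure := by
            gcongr
            exact le_self_add
        _ = _ := (lintegral_const_mul _ hmeas).symm
    · refine Or.inl (Or.inr ⟨hhub, ?_⟩)
      have h1 : 1 ≤ D.measure (Metric.ball c (κ * s)) := by
        rw [← D.measure_core x.idx]
        exact measure_mono (Set.singleton_subset_iff.2 (hBB hcore))
      calc t ^ q * D.measure (D.hub x.idx)
          ≤ t ^ q * (2 * D.measure (Metric.ball c (κ * s))) := by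
            gcongr
            exact (D.measure_hub_le _).trans (le_mul_of_one_le_right zero_le h1)
        _ = 2 * (t ^ q * D.measure (Metric.ball c (κ * s))) := mul_left_comm _ _ _
        _ ≤ 2 * ∫⁻ y in Metric.ball c s, F y ^ q ∂D.measure := by gcongr
        _ ≤ 2 * ∫⁻ y in D.piece x.idx, F y ^ q ∂D.measure := by gcongr
        _ = _ := (lintegral_const_mul _ hmeas).symm
    -- The only dangerous balls: here the hypothesis on `S` enters. Either the value at the tip or
    -- the integral over the hub accounts for half of the average.
    · obtain ⟨n, b⟩ := x
      change Fin (D.num n) at i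
      obtain rfl : b = .tip i := hi
      simp only at hB hfar hin hxS
      have hnS := hxS hfar hin
      have hM : (2 ^ n : ℝ≥0∞) ≤ D.measure (Metric.ball c (κ * s)) := by
        rw [← D.measure_tip n i]
        exact measure_mono (Set.singleton_subset_iff.2 (hBB hxB))
      have hle : t * 2 ^ n ≤
          ∫⁻ y in D.hub n, F y ∂D.measure + F ⟨n, .tip i⟩ * 2 ^ n :=
        calc t * 2 ^ n ≤ t * D.measure (Metric.ball c (κ * s)) := by gcongr
          _ ≤ ∫⁻ y in Metric.ball c s, F y ∂D.measure :=
              (ENNReal.le_div_iff_mul_le (Or.inl hpos) (Or.inl hfin)).1 ht.le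
          _ ≤ ∫⁻ y in D.hub n ∪ {⟨n, .tip i⟩}, F y ∂D.measure := lintegral_mono_set hB
          _ ≤ _ := by
              refine (lintegral_union_le _ _ _).trans ?_
              rw [lintegral_singleton, measure_tip]
      have hM0 : (2 ^ n : ℝ≥0∞) ≠ 0 := by simp
      have hMtop : (2 ^ n : ℝ≥0∞) ≠ ∞ := ENNReal.pow_ne_top (by simp)
      rcases le_total (∫⁻ y in D.hub n, F y ∂D.measure) (F ⟨n, .tip i⟩ * 2 ^ n) with h | h
      · refine Or.inl (Or.inl (Or.inl (Or.inr ?_)))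
        have h2 : t * 2 ^ n ≤ (2 * F ⟨n, .tip i⟩) * 2 ^ n := by
          rw [mul_assoc, two_mul]
          exact hle.trans (by gcongr)
        have h3 := ENNReal.rpow_le_rpow ((ENNReal.mul_le_mul_iff_left hM0 hMtop).1 h2) hq0
        rw [ENNReal.mul_rpow_of_nonneg _ _ hq0] at h3
        have h4 : t ^ q * D.measure {(⟨n, .tip i⟩ : D.Point)} ≤
            ∫⁻ y in {(⟨n, .tip i⟩ : D.Point)}, 2 ^ q * F y ^ q ∂D.measure := by
          rw [lintegral_singleton]
          gcongr
        exact h4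
      · refine Or.inr ?_
        have h2 : t * 2 ^ n ≤ 2 * ∫⁻ y in D.hub n, F y ∂D.measure := by
          rw [two_mul]
          exact hle.trans (by gcongr)
        -- One factor `2 ^ q` comes from the halving, the other from Hölder's inequality on the hub,
        -- of mass at most `2`.
        have h3 : t ^ q * (2 ^ n) ^ q ≤ 4 ^ q * ∫⁻ y in D.piece n, F y ^ q ∂D.measure :=
          calc t ^ q * (2 ^ n) ^ q = (t * 2 ^ n) ^ q := (ENNReal.mul_rpow_of_nonneg _ _ hq0).symm
            _ ≤ (2 * ∫⁻ y in D.hub n, F y ∂D.measure) ^ q := ENNReal.rpow_le_rpow h2 hq0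
            _ = 2 ^ q * (∫⁻ y in D.hub n, F y ∂D.measure) ^ q :=
                ENNReal.mul_rpow_of_nonneg _ _ hq0
            _ ≤ 2 ^ q * (D.measure (D.hub n) ^ (q - 1) * ∫⁻ y in D.hub n, F y ^ q ∂D.measure) := by
                gcongr
                exact setLIntegral_rpow_le F _ hq
            _ ≤ 2 ^ q * (2 ^ q * ∫⁻ y in D.piece n, F y ^ q ∂D.measure) := by
                gcongr
                · exact (ENNReal.rpow_le_rpow (D.measure_hub_le n) (by linarith)).trans
                    (ENNReal.rpow_le_rpow_of_exponent_le one_le_two (by linarith))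
                · exact fun z hz => hz.1
            _ = 4 ^ q * ∫⁻ y in D.piece n, F y ^ q ∂D.measure := by
                rw [← mul_assoc, ← ENNReal.mul_rpow_of_nonneg _ _ hq0]
                norm_num
        calc t ^ q * D.measure (D.piece n) ≤ t ^ q * (K * (2 ^ n) ^ q) := by
              gcongr
              exact hS n hnS
          _ = K * (t ^ q * (2 ^ n) ^ q) := mul_left_comm _ _ _
          _ ≤ K * (4 ^ q * ∫⁻ y in D.piece n, F y ^ q ∂D.measure) := by gcongr
          _ = K * 4 ^ q * ∫⁻ y in D.piece n, F y ^ q ∂D.measure := (mul_assoc _ _ _).symm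
          _ ≤ (2 + K * 4 ^ q) * ∫⁻ y in D.piece n, F y ^ q ∂D.measure := by
              gcongr
              exact le_add_self
          _ = _ := (lintegral_const_mul _ hmeas).symm
  have h₁ : t ^ q * D.measure E₁ ≤ 1 * ∫⁻ y, F y ^ q ∂D.measure := by
    rw [one_mul]
    exact mul_measure_biUnion_le_of_monotone D.initial_mono fun k hk => hk
  have h₂ : t ^ q * D.measure E₂ ≤ 2 ^ q * ∫⁻ y, F y ^ q ∂D.measure := by
    rw [← lintegral_const_mul _ hmeas]
    refine mul_measure_le_lintegral_of_fibers id fun x hx => le_trans ?_ hx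
    gcongr
    exact Set.inter_subset_right
  have h₃ : t ^ q * D.measure E₃ ≤ 1 * ∫⁻ y, F y ^ q ∂D.measure := by
    rw [one_mul]
    refine mul_measure_le_lintegral_of_fibers Point.label fun x hx => le_trans ?_ hx
    gcongr
    exact Set.inter_subset_right
  have h₄ : t ^ q * D.measure E₄ ≤ 2 * ∫⁻ y, F y ^ q ∂D.measure := by
    rw [← lintegral_const_mul _ hmeas]
    refine mul_measure_le_lintegral_of_fibers Point.idx fun x hx => le_trans ?_ hx.2
    gcongr
    rintro y ⟨hy, hyx⟩
    obtain hyx : y.idx = x.idx := hyx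
    exact hyx ▸ hy.1
  have h₅ : t ^ q * D.measure E₅ ≤ (2 + K * 4 ^ q) * ∫⁻ y, F y ^ q ∂D.measure := by
    rw [← lintegral_const_mul _ hmeas]
    refine mul_measure_le_lintegral_of_fibers Point.idx fun x hx => le_trans ?_ hx
    gcongr
    exact Set.inter_subset_right
  calc t ^ q * D.measure E
      ≤ t ^ q * (D.measure E₁ + D.measure E₂ + D.measure E₃ + D.measure E₄ + D.measure E₅) := by
        gcongr
        refine (measure_mono hsub).trans ?_
        refine (measure_union_le _ _).trans (add_le_add_left ?_ _)
        refine (measure_union_le _ _).trans (add_le_add_left ?_ _)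
        refine (measure_union_le _ _).trans (add_le_add_left ?_ _)
        exact measure_union_le _ _
    _ ≤ _ := by
        simp only [mul_add, add_mul _ _ (∫⁻ y, F y ^ q ∂D.measure)]
        simp only [add_mul] at h₅
        gcongr

end StarShape

/-! ### Criteria for weak type in terms of the masses of pieces -/

namespace StarShape

variable {D : StarShape} {κ : ℝ} {p : ℝ≥0∞}

lemma isWeakType_centeredMaximal (hκ : 1 ≤ κ) (hp : 1 ≤ p) (hptop : p ≠ ∞) {K : ℝ≥0∞}
    (hK : K ≠ ∞) (hS : ∀ n ∈ {n | κ < D.far n ∧ D.inner n},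
      D.measure (D.piece n) ≤ K * (2 ^ n) ^ p.toReal) :
    IsWeakType D.measure p (centeredMaximal D.measure κ) := by
  have hq : 1 ≤ p.toReal := by simpa using ENNReal.toReal_mono hptop hp
  refine isWeakType_of_distribution_le hp hptop (K := _) ?_ fun f t _ =>
    rpow_mul_measure_le hκ hq hS (fun y => ‖f y‖ₑ) fun x hx => ?_
  · have h : ∀ a : ℝ≥0∞, a ≠ ∞ → a ^ p.toReal ≠ ∞ := fun a ha =>
      ENNReal.rpow_ne_top_of_nonneg (by linarith) ha
    have h2 := h 2 (by simp)
    have h4 := h 4 (by simp)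
    finiteness
  · obtain ⟨s, hx⟩ := lt_iSup_iff.1 (show (t : ℝ≥0∞) < centeredMaximal D.measure κ f x from hx)
    obtain ⟨hs, hx⟩ := lt_iSup_iff.1 hx
    exact ⟨x, s, hs, Metric.mem_ball_self hs, hx, fun h1 h2 => ⟨h1, h2 rfl⟩⟩

lemma isWeakType_noncenteredMaximal (hκ : 1 ≤ κ) (hp : 1 ≤ p) (hptop : p ≠ ∞) {K : ℝ≥0∞}
    (hK : K ≠ ∞) (hS : ∀ n ∈ {n | κ < D.far n},
      D.measure (D.piece n) ≤ K * (2 ^ n) ^ p.toReal) :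
    IsWeakType D.measure p (noncenteredMaximal D.measure κ) := by
  have hq : 1 ≤ p.toReal := by simpa using ENNReal.toReal_mono hptop hp
  refine isWeakType_of_distribution_le hp hptop (K := _) ?_ fun f t _ =>
    rpow_mul_measure_le hκ hq hS (fun y => ‖f y‖ₑ) fun x hx => ?_
  · have h : ∀ a : ℝ≥0∞, a ≠ ∞ → a ^ p.toReal ≠ ∞ := fun a ha =>
      ENNReal.rpow_ne_top_of_nonneg (by linarith) ha
    have h2 := h 2 (by simp)
    have h4 := h 4 (by simp)
    finiteness
  · obtain ⟨c, hx⟩ :=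
      lt_iSup_iff.1 (show (t : ℝ≥0∞) < noncenteredMaximal D.measure κ f x from hx)
    obtain ⟨s, hx⟩ := lt_iSup_iff.1 hx
    obtain ⟨hs, hx⟩ := lt_iSup_iff.1 hx
    obtain ⟨hxB, hx⟩ := lt_iSup_iff.1 hx
    exact ⟨c, s, hs, hxB, hx, fun h1 _ => h1⟩

variable (D) in
/-- The indicator function of the core of the `n`-th piece. -/
noncomputable def coreIndicator (n : ℕ) : D.Point → ℂ :=
  Set.indicator {⟨n, .core⟩} fun _ => 1

lemma eLpNorm_coreIndicator (hp : 1 ≤ p) (hptop : p ≠ ∞) (n : ℕ) :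
    eLpNorm (D.coreIndicator n) p D.measure = 1 := by
  rw [coreIndicator, eLpNorm_indicator_const (measurableSet_singleton _)
    (one_pos.trans_le hp).ne' hptop, measure_core]
  simp

lemma memLp_coreIndicator (hp : 1 ≤ p) (hptop : p ≠ ∞) (n : ℕ) :
    MemLp (D.coreIndicator n) p D.measure :=
  ⟨(Measurable.of_discrete).aestronglyMeasurable, by simp [eLpNorm_coreIndicator hp hptop]⟩

lemma inv_le_average_coreIndicator {n : ℕ} {i : Fin (D.num n)} {B B' : Set D.Point}
    (hB : (⟨n, .core⟩ : D.Point) ∈ B) (hB' : B' ⊆ D.hub n ∪ {⟨n, .tip i⟩}) :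
    (3 * 2 ^ n)⁻¹ ≤ (∫⁻ y in B, ‖D.coreIndicator n y‖ₑ ∂D.measure) / D.measure B' := by
  have h1 : 1 ≤ ∫⁻ y in B, ‖D.coreIndicator n y‖ₑ ∂D.measure :=
    calc (1 : ℝ≥0∞) = ∫⁻ y in {(⟨n, .core⟩ : D.Point)}, ‖D.coreIndicator n y‖ₑ ∂D.measure := by
          rw [lintegral_singleton, measure_core]
          simp [coreIndicator]
      _ ≤ _ := lintegral_mono_set (Set.singleton_subset_iff.2 hB)
  have h2 : D.measure B' ≤ 3 * 2 ^ n :=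
    calc D.measure B' ≤ D.measure (D.hub n) + D.measure {⟨n, .tip i⟩} :=
          (measure_mono hB').trans (measure_union_le _ _)
      _ ≤ 2 * 2 ^ n + 2 ^ n := by
          rw [measure_tip]
          gcongr
          exact (D.measure_hub_le n).trans (le_mul_of_one_le_right zero_le (one_le_pow₀ one_le_two))
      _ = 3 * 2 ^ n := by ring
  rw [ENNReal.div_eq_inv_mul]
  calc (3 * 2 ^ n : ℝ≥0∞)⁻¹ ≤ (D.measure B')⁻¹ := ENNReal.inv_le_inv.2 h2
    _ ≤ _ := le_mul_of_one_le_right zero_le h1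

lemma inv_le_centeredMaximal (hκ : 1 ≤ κ) {n : ℕ} (hfar : κ < D.far n) (hin : D.inner n)
    (i : Fin (D.num n)) :
    (3 * 2 ^ n)⁻¹ ≤ centeredMaximal D.measure κ (D.coreIndicator n) ⟨n, .tip i⟩ := by
  have hκ0 : 0 < κ := one_pos.trans_le hκ
  have hs1 : 1 < D.far n / κ := (one_lt_div hκ0).2 hfar
  -- The radius exceeds `1`, so the core is reached, and the dilated radius is exactly `far n`, so
  -- the open ball misses the other tips.
  refine le_iSup₂_of_le (D.far n / κ) (one_pos.trans hs1) ?_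
  rw [mul_div_cancel₀ _ hκ0.ne']
  refine inv_le_average_coreIndicator (i := i) ?_ ?_
  · rw [mem_ball_mk]
    simpa only [StarNode.dist, D.tipDist_of_inner hin] using hs1
  · rintro ⟨m, b⟩ hz
    have h3 : D.far n ≤ 3 + ((⟨n, .tip i⟩ : D.Point).idx : ℝ) :=
      (D.far_le_three n).trans (le_add_of_nonneg_right (Nat.cast_nonneg _))
    obtain rfl : m = n := ball_subset_piece h3 hz
    cases b with
    | core => exact Or.inl ⟨rfl, by simp⟩
    | mid k => exact Or.inl ⟨rfl, by simp⟩
    | tip k =>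
      by_cases h : k = i
      · exact Or.inr (by rw [h]; rfl)
      · simp only [mem_ball_mk, StarNode.dist, if_neg h, min_eq_left (D.far_le_two m hin),
          lt_irrefl] at hz

lemma inv_le_noncenteredMaximal (hκ : 1 ≤ κ) {n : ℕ} (hfar : κ < D.far n) (i : Fin (D.num n)) :
    (3 * 2 ^ n)⁻¹ ≤ noncenteredMaximal D.measure κ (D.coreIndicator n) ⟨n, .tip i⟩ := by
  have hκ0 : 0 < κ := one_pos.trans_le hκ
  have hs1 : 1 < D.far n / κ := (one_lt_div hκ0).2 hfar
  have hx : (⟨n, .tip i⟩ : D.Point) ∈ Metric.ball (⟨n, .mid i⟩ : D.Point) (D.far n / κ) := by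
    rw [mem_ball_mk]
    simpa only [StarNode.dist, if_true] using hs1
  refine le_iSup_of_le ⟨n, .mid i⟩ (le_iSup₂_of_le (D.far n / κ) (one_pos.trans hs1)
    (le_iSup_of_le hx ?_))
  rw [mul_div_cancel₀ _ hκ0.ne']
  refine inv_le_average_coreIndicator (i := i) ?_ ?_
  · rw [mem_ball_mk]
    simpa only [StarNode.dist] using hs1
  · rintro ⟨m, b⟩ hz
    have h3 : D.far n ≤ 3 + ((⟨n, .mid i⟩ : D.Point).idx : ℝ) :=
      (D.far_le_three n).trans (le_add_of_nonneg_right (Nat.cast_nonneg _))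
    obtain rfl : m = n := ball_subset_piece h3 hz
    cases b with
    | core => exact Or.inl ⟨rfl, by simp⟩
    | mid k => exact Or.inl ⟨rfl, by simp⟩
    | tip k =>
      by_cases h : k = i
      · exact Or.inr (by rw [h]; rfl)
      · simp only [mem_ball_mk, StarNode.dist, if_neg h, lt_irrefl] at hz

/-- The test functions are the core indicators, of norm `1`: their images are large on all tips,
whose total mass is `num n * 2 ^ n`. -/
lemma exists_bound_of_isWeakType (hp : 1 ≤ p) (hptop : p ≠ ∞)
    {T : (D.Point → ℂ) → D.Point → ℝ≥0∞} (hT : IsWeakType D.measure p T) {S : Set ℕ}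
    (hS : ∀ n ∈ S, ∀ i, (3 * 2 ^ n)⁻¹ ≤ T (D.coreIndicator n) ⟨n, .tip i⟩) :
    ∃ K : ℝ≥0∞, K ≠ ∞ ∧ ∀ n ∈ S, D.num n * 2 ^ n ≤ K * (2 ^ n) ^ p.toReal := by
  have hq : 0 ≤ p.toReal := ENNReal.toReal_nonneg
  obtain ⟨C, hC⟩ := distribution_le_of_isWeakType hp hptop hT
  refine ⟨(C * 4) ^ p.toReal, ENNReal.rpow_ne_top_of_nonneg hq (by finiteness), fun n hn => ?_⟩
  -- The constant `4` in place of `3` makes the inequality at the tips strict.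
  have h := hC _ (memLp_coreIndicator hp hptop n) (4 * 2 ^ n)⁻¹ (by positivity)
  rw [eLpNorm_coreIndicator hp hptop, mul_one,
    ENNReal.coe_inv (by positivity)] at h
  push_cast at h
  have hsub : D.tips n ⊆ {x | (4 * 2 ^ n : ℝ≥0∞)⁻¹ < T (D.coreIndicator n) x} := by
    rintro ⟨m, b⟩ ⟨h1, i, hi⟩
    obtain rfl : m = n := h1
    change Fin (D.num m) at i
    obtain rfl : b = .tip i := hi
    refine lt_of_lt_of_le (ENNReal.inv_lt_inv.2 ?_) (hS m hn i)
    have h2 : (2 ^ m : ℝ≥0∞) ≠ ∞ := ENNReal.pow_ne_top (by simp)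
    exact (ENNReal.mul_lt_mul_iff_left (by simp) h2).2 (by norm_num)
  have h' : ((4 * 2 ^ n : ℝ≥0∞)⁻¹) ^ p.toReal * (D.num n * 2 ^ n) ≤ (C : ℝ≥0∞) ^ p.toReal := by
    rw [← measure_tips]
    exact le_trans (by gcongr) h
  have h4 : (4 * 2 ^ n : ℝ≥0∞) ≠ 0 := by simp
  have h4' : (4 * 2 ^ n : ℝ≥0∞) ≠ ∞ := by finiteness
  rw [ENNReal.inv_rpow, ← ENNReal.div_eq_inv_mul, ENNReal.div_le_iff
    (ENNReal.rpow_pos (pos_iff_ne_zero.2 h4) h4').ne' (ENNReal.rpow_ne_top_of_nonneg hq h4'),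
    ENNReal.mul_rpow_of_nonneg _ _ hq, ← mul_assoc, ← ENNReal.mul_rpow_of_nonneg _ _ hq] at h'
  exact h'

end StarShape

/-! ### Growth of the number of branches -/

section Growth

/-- The number of branches for which the weak type `(q, q)` constants of a piece blow up exactly
for `q ≤ e n`. -/
noncomputable def branchNumber (e : ℕ → ℝ) (n : ℕ) : ℕ := ⌈(n + 1) * (2 ^ n : ℝ) ^ (e n - 1)⌉₊

variable {e : ℕ → ℝ}

lemma branchNumber_pos (n : ℕ) : 0 < branchNumber e n := Nat.ceil_pos.2 (by positivity)

lemma two_pow_rpow_eq_ofReal (n : ℕ) (q : ℝ) :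
    ((2 : ℝ≥0∞) ^ n) ^ q = ENNReal.ofReal ((2 ^ n : ℝ) ^ q) := by
  rw [← ENNReal.ofReal_rpow_of_pos (by positivity), ENNReal.ofReal_pow (by norm_num)]
  simp

lemma rpow_mul_self_eq (n : ℕ) : (2 ^ n : ℝ) ^ (e n - 1) * 2 ^ n = (2 ^ n : ℝ) ^ e n := by
  rw [Real.rpow_sub_one (by positivity), div_mul_cancel₀ _ (by positivity)]

/-- The surplus factor `n + 1` is what makes weak type fail even at the endpoint `q = e n`. -/
lemma le_branchNumber_mul {n : ℕ} {q : ℝ} (hq : q ≤ e n) :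
    ((n + 1 : ℕ) : ℝ≥0∞) * (2 ^ n) ^ q ≤ branchNumber e n * 2 ^ n := by
  have h : ((n + 1 : ℕ) : ℝ) * (2 ^ n : ℝ) ^ q ≤ branchNumber e n * 2 ^ n :=
    calc ((n + 1 : ℕ) : ℝ) * (2 ^ n : ℝ) ^ q ≤ (n + 1) * (2 ^ n : ℝ) ^ e n := by
          push_cast
          gcongr
          exact one_le_pow₀ one_le_two
      _ = ((n + 1) * (2 ^ n : ℝ) ^ (e n - 1)) * 2 ^ n := by rw [mul_assoc, rpow_mul_self_eq]
      _ ≤ _ := by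
          gcongr
          exact Nat.le_ceil _
  have h' := ENNReal.ofReal_le_ofReal h
  rwa [ENNReal.ofReal_mul (by positivity), ENNReal.ofReal_mul (by positivity),
    ENNReal.ofReal_natCast, ENNReal.ofReal_natCast, ← two_pow_rpow_eq_ofReal,
    ENNReal.ofReal_pow (by norm_num), ENNReal.ofReal_ofNat] at h'

lemma exists_natCast_add_one_le_two_pow_rpow {δ : ℝ} (hδ : 0 < δ) :
    ∃ C : ℝ, 0 ≤ C ∧ ∀ n : ℕ, (n + 1 : ℝ) ≤ C * (2 ^ n : ℝ) ^ δ := by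
  have hr1 : (2 : ℝ) ^ (-δ) < 1 := Real.rpow_lt_one_of_one_lt_of_neg one_lt_two (by linarith)
  have hr0 : (0 : ℝ) < 2 ^ (-δ) := by positivity
  obtain ⟨C, hC⟩ := (tendsto_self_mul_const_pow_of_lt_one hr0.le hr1).bddAbove_range
  have hC' : ∀ n : ℕ, n * ((2 : ℝ) ^ (-δ)) ^ n ≤ C := fun n => hC ⟨n, rfl⟩
  have hC0 : 0 ≤ C := by simpa using hC' 0
  refine ⟨C + 1, by linarith, fun n => ?_⟩
  have hone : ((2 : ℝ) ^ (-δ)) ^ n * (2 ^ n : ℝ) ^ δ = 1 := by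
    rw [← Real.rpow_natCast ((2 : ℝ) ^ (-δ)), ← Real.rpow_natCast (2 : ℝ),
      ← Real.rpow_mul (by norm_num), ← Real.rpow_mul (by norm_num),
      ← Real.rpow_add (by norm_num)]
    ring_nf
    simp
  have hpos : (0 : ℝ) < (2 ^ n : ℝ) ^ δ := by positivity
  have h1 : (1 : ℝ) ≤ (2 ^ n : ℝ) ^ δ := Real.one_le_rpow (one_le_pow₀ one_le_two) hδ.le
  have h2 : (n : ℝ) ≤ C * (2 ^ n : ℝ) ^ δ :=
    calc (n : ℝ) = n * ((2 : ℝ) ^ (-δ)) ^ n * (2 ^ n : ℝ) ^ δ := by rw [mul_assoc, hone, mul_one]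
      _ ≤ _ := by
        gcongr
        exact hC' n
  linarith

/-- The gap between `q'` and `q` yields a factor `(2 ^ n) ^ (q - q')` that absorbs `n + 1`. -/
lemma exists_branchNumber_mul_le {q q' : ℝ} (hq' : q' < q) (he : ∀ n, 1 ≤ e n) :
    ∃ K : ℝ≥0∞, K ≠ ∞ ∧ ∀ n, e n ≤ q' →
      2 + (branchNumber e n : ℝ≥0∞) * 2 ^ n ≤ K * (2 ^ n) ^ q := by
  obtain ⟨C, hC0, hC⟩ := exists_natCast_add_one_le_two_pow_rpow (sub_pos.2 hq')
  refine ⟨ENNReal.ofReal (4 * C), ENNReal.ofReal_ne_top, fun n hn => ?_⟩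
  have h2n : (1 : ℝ) ≤ 2 ^ n := one_le_pow₀ one_le_two
  have hn1 : (1 : ℝ) ≤ n + 1 := by linarith [n.cast_nonneg (α := ℝ)]
  have hbase : (1 : ℝ) ≤ (n + 1) * (2 ^ n : ℝ) ^ (e n - 1) := by
    have h := Real.one_le_rpow h2n (sub_nonneg.2 (he n))
    nlinarith
  have hceil : (branchNumber e n : ℝ) ≤ 2 * ((n + 1) * (2 ^ n : ℝ) ^ (e n - 1)) := by
    have := (Nat.ceil_lt_add_one (zero_le_one.trans hbase)).le
    rw [branchNumber]
    linarith
  have hpow : (2 ^ n : ℝ) ^ e n ≤ (2 ^ n : ℝ) ^ q' := Real.rpow_le_rpow_of_exponent_le h2n hn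
  have hpow1 : (1 : ℝ) ≤ (2 ^ n : ℝ) ^ q' :=
    (Real.one_le_rpow h2n (zero_le_one.trans (he n))).trans hpow
  have h : 2 + (branchNumber e n : ℝ) * 2 ^ n ≤ 4 * C * (2 ^ n : ℝ) ^ q :=
    calc 2 + (branchNumber e n : ℝ) * 2 ^ n
        ≤ 2 + 2 * ((n + 1) * (2 ^ n : ℝ) ^ (e n - 1)) * 2 ^ n := by gcongr
      _ = 2 + 2 * ((n + 1) * (2 ^ n : ℝ) ^ e n) := by rw [← rpow_mul_self_eq]; ring
      _ ≤ 2 * ((n + 1) * (2 ^ n : ℝ) ^ q') + 2 * ((n + 1) * (2 ^ n : ℝ) ^ q') := by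
          gcongr
          nlinarith
      _ = 4 * (n + 1) * (2 ^ n : ℝ) ^ q' := by ring
      _ ≤ 4 * (C * (2 ^ n : ℝ) ^ (q - q')) * (2 ^ n : ℝ) ^ q' := by
          gcongr
          exact hC n
      _ = 4 * C * (2 ^ n : ℝ) ^ q := by
          rw [← mul_assoc, mul_assoc (4 * C), ← Real.rpow_add (by positivity), sub_add_cancel]
  have h' := ENNReal.ofReal_le_ofReal h
  rwa [ENNReal.ofReal_add (by norm_num) (by positivity), ENNReal.ofReal_mul (by positivity),
    ENNReal.ofReal_mul (by positivity),
    ENNReal.ofReal_natCast, ← two_pow_rpow_eq_ofReal,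
    ENNReal.ofReal_pow (by norm_num), ENNReal.ofReal_ofNat] at h'

end Growth

namespace StarShape

open Filter

variable {D : StarShape} {e : ℕ → ℝ} {q : ℝ} {S : Set ℕ}

lemma exists_measure_piece_le (hD : D.num = branchNumber e) (he : ∀ n, 1 ≤ e n) {q' : ℝ}
    (hq : 0 < q) (hq' : q' < q) (hS : ∀ᶠ n in atTop, n ∈ S → e n ≤ q') :
    ∃ K : ℝ≥0∞, K ≠ ∞ ∧ ∀ n ∈ S, D.measure (D.piece n) ≤ K * (2 ^ n) ^ q := by
  obtain ⟨K, hK, hKn⟩ := exists_branchNumber_mul_le hq' he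
  obtain ⟨n₀, hn₀⟩ := eventually_atTop.1 hS
  have hfin : ∀ n, D.measure (D.piece n) ≠ ∞ := fun n =>
    ne_top_of_le_ne_top (by finiteness) (D.measure_piece_le n)
  -- The finitely many exceptional pieces have finite mass and are absorbed into the constant.
  refine ⟨K + ∑ n ∈ Finset.range n₀, D.measure (D.piece n),
    ENNReal.add_ne_top.2 ⟨hK, ENNReal.sum_ne_top.2 fun n _ => hfin n⟩, fun n hn => ?_⟩
  rcases lt_or_ge n n₀ with h | h
  · calc D.measure (D.piece n) ≤ ∑ n ∈ Finset.range n₀, D.measure (D.piece n) :=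
          Finset.single_le_sum (f := fun n => D.measure (D.piece n)) (fun _ _ => zero_le)
            (Finset.mem_range.2 h)
      _ ≤ K + ∑ n ∈ Finset.range n₀, D.measure (D.piece n) := le_add_self
      _ ≤ _ := le_mul_of_one_le_right zero_le
          (ENNReal.one_le_rpow (one_le_pow₀ one_le_two) hq)
  · refine (D.measure_piece_le n).trans ?_
    rw [hD]
    refine (hKn n (hn₀ n h hn)).trans ?_
    gcongr
    exact le_self_add

lemma not_exists_bound (hD : D.num = branchNumber e)
    (hS : ∃ᶠ n in atTop, n ∈ S ∧ q ≤ e n) :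
    ¬ ∃ K : ℝ≥0∞, K ≠ ∞ ∧ ∀ n ∈ S, D.num n * 2 ^ n ≤ K * (2 ^ n) ^ q := by
  rintro ⟨K, hK, hKn⟩
  obtain ⟨N, hN⟩ := ENNReal.exists_nat_gt hK
  obtain ⟨n, hn, hnS, hnq⟩ := frequently_atTop.1 hS N
  have h := (le_branchNumber_mul hnq).trans (hD ▸ hKn n hnS)
  have hpos : ((2 : ℝ≥0∞) ^ n) ^ q ≠ 0 := (ENNReal.rpow_pos (ENNReal.pow_pos (by simp) n) (by finiteness)).ne'
  have htop : ((2 : ℝ≥0∞) ^ n) ^ q ≠ ∞ := by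
    rw [two_pow_rpow_eq_ofReal]
    exact ENNReal.ofReal_ne_top
  have h1 := (ENNReal.mul_le_mul_iff_left hpos htop).1 h
  refine absurd (hN.trans_le ?_) (not_lt.2 h1)
  exact_mod_cast hn.trans n.le_succ

end StarShape

/-! ### Assembly of the space -/

open Filter in
theorem theorem3p3p1 (hc h : ℝ → ℝ≥0∞)
    (hc_one_le : ∀ κ ∈ Set.Icc (1 : ℝ) 2, 1 ≤ hc κ)
    (h_one_le : ∀ κ ∈ Set.Icc (1 : ℝ) 3, 1 ≤ h κ)
    (hc_anti : AntitoneOn hc (Set.Icc (1 : ℝ) 2))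
    (h_anti : AntitoneOn h (Set.Icc (1 : ℝ) 3))
    (hc_le_h : ∀ κ ∈ Set.Icc (1 : ℝ) 2, hc κ ≤ h κ)
    (hc_two : hc 2 = 1) (h_three : h 3 = 1) :
    ∃ (Z : Type) (_ : Nonempty Z) (_ : MetricSpace Z) (_ : MeasurableSpace Z) (_ : BorelSpace Z)
      (μ : Measure Z),
      (∀ (x : Z) (s : ℝ), 0 < s → 0 < μ (Metric.ball x s) ∧ μ (Metric.ball x s) < ∞) ∧
      (∀ κ ∈ Set.Ico (1 : ℝ) 2, ∀ p : ℝ≥0∞, 1 ≤ p →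
        (IsWeakType μ p (centeredMaximal μ κ) ↔ hc κ < p ∨ p = ∞)) ∧
      (∀ κ ∈ Set.Ico (1 : ℝ) 3, ∀ p : ℝ≥0∞, 1 ≤ p →
        (IsWeakType μ p (noncenteredMaximal μ κ) ↔ h κ < p ∨ p = ∞)) := by
  obtain ⟨τc, ec, τc_gt, τc_le, ec_ge, hcrect⟩ :=
    exists_rectangles one_lt_two hc_one_le hc_anti
  obtain ⟨τ, e', τ_gt, τ_le, e'_ge, hrect⟩ :=
    exists_rectangles (by norm_num : (1 : ℝ) < 3) h_one_le h_anti
  -- Even pieces are inner and encode `hc`; odd pieces are not and encode `h`.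
  set far : ℕ → ℝ := fun n => if Even n then τc (n / 2) else τ (n / 2) with hfar
  set e : ℕ → ℝ := fun n => if Even n then ec (n / 2) else e' (n / 2) with he
  have far_even : ∀ n, Even n → far n = τc (n / 2) := fun n hn => if_pos hn
  have far_odd : ∀ n, ¬ Even n → far n = τ (n / 2) := fun n hn => if_neg hn
  have e_even : ∀ n, Even n → e n = ec (n / 2) := fun n hn => if_pos hn
  have e_odd : ∀ n, ¬ Even n → e n = e' (n / 2) := fun n hn => if_neg hn
  have e_ge : ∀ n, 1 ≤ e n := fun n => by
    simp only [he]
    split_ifs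
    exacts [ec_ge _, e'_ge _]
  let D : StarShape :=
    { num := branchNumber e
      num_pos := branchNumber_pos
      far := far
      one_lt_far := fun n => by
        simp only [hfar]
        split_ifs
        exacts [τc_gt _, τ_gt _]
      far_le_three := fun n => by
        simp only [hfar]
        split_ifs
        exacts [(τc_le _).trans (by norm_num), τ_le _]
      inner := Even
      far_le_two := fun n hn => (far_even n hn).trans_le (τc_le _) }
  have half_tendsto : Tendsto (fun n : ℕ => n / 2) atTop atTop :=
    Nat.tendsto_div_const_atTop two_ne_zero
  have hrange : ∀ {a b : ℝ≥0∞}, ¬ (b < a ∨ a = ∞) → a ≠ ∞ ∧ a ≤ b := by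
    intro a b hab
    rw [not_or, not_lt] at hab
    exact ⟨hab.2, hab.1⟩
  refine ⟨D.Point, inferInstance, inferInstance, inferInstance, inferInstance, D.measure,
    fun x s hs => ⟨D.measure_pos (Metric.mem_ball_self hs), D.measure_ball_lt_top x s⟩,
    fun κ hκ p hp => ⟨fun hT => ?_, fun hlt => ?_⟩, fun κ hκ p hp => ⟨fun hT => ?_, fun hlt => ?_⟩⟩
  · by_contra hcon
    obtain ⟨hptop, hple⟩ := hrange hcon
    rw [← ENNReal.ofReal_toReal hptop] at hple
    refine StarShape.not_exists_bound (D := D) rfl ?_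
      (StarShape.exists_bound_of_isWeakType hp hptop hT
        (S := {n | κ < D.far n ∧ D.inner n}) fun n hn i =>
          StarShape.inv_le_centeredMaximal hκ.1 hn.1 hn.2 i)
    have hfreq := (hcrect κ hκ p.toReal).1 hple
    rw [frequently_atTop] at hfreq ⊢
    intro N
    obtain ⟨k, hk, hk1, hk2⟩ := hfreq N
    have heven : Even (2 * k) := even_two_mul k
    have hdiv : 2 * k / 2 = k := by omega
    exact ⟨2 * k, by omega, ⟨by rw [← hdiv, ← far_even _ heven] at hk1; exact hk1, heven⟩,
      by rwa [e_even _ heven, hdiv]⟩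
  · by_cases hptop : p = ∞
    · rw [hptop]
      exact isWeakType_top_centeredMaximal hκ.1
    have hlt' := hlt.resolve_right hptop
    rw [← ENNReal.ofReal_toReal hptop] at hlt'
    obtain ⟨q', hq', hev⟩ := (hcrect κ hκ p.toReal).2 hlt'
    have hq0 : 0 < p.toReal := ENNReal.toReal_pos (one_pos.trans_le hp).ne' hptop
    obtain ⟨K, hK, hKS⟩ := StarShape.exists_measure_piece_le (D := D) rfl e_ge hq0 hq'
      (S := {n | κ < D.far n ∧ D.inner n}) (by
        filter_upwards [half_tendsto.eventually hev] with n hn hnS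
        rw [e_even n hnS.2]
        exact hn (far_even n hnS.2 ▸ hnS.1))
    exact StarShape.isWeakType_centeredMaximal hκ.1 hp hptop hK hKS
  · by_contra hcon
    obtain ⟨hptop, hple⟩ := hrange hcon
    rw [← ENNReal.ofReal_toReal hptop] at hple
    refine StarShape.not_exists_bound (D := D) rfl ?_
      (StarShape.exists_bound_of_isWeakType hp hptop hT
        (S := {n | κ < D.far n}) fun n hn i =>
          StarShape.inv_le_noncenteredMaximal hκ.1 hn i)
    have hfreq := (hrect κ hκ p.toReal).1 hple
    rw [frequently_atTop] at hfreq ⊢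
    intro N
    obtain ⟨k, hk, hk1, hk2⟩ := hfreq N
    have hodd : ¬ Even (2 * k + 1) := Nat.not_even_two_mul_add_one k
    have hdiv : (2 * k + 1) / 2 = k := by omega
    exact ⟨2 * k + 1, by omega, by rw [← hdiv, ← far_odd _ hodd] at hk1; exact hk1,
      by rwa [e_odd _ hodd, hdiv]⟩
  · by_cases hptop : p = ∞
    · rw [hptop]
      exact isWeakType_top_noncenteredMaximal hκ.1
    have hlt' := hlt.resolve_right hptop
    rw [← ENNReal.ofReal_toReal hptop] at hlt'
    obtain ⟨q', hq', hev⟩ := (hrect κ hκ p.toReal).2 hlt'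
    have hq0 : 0 < p.toReal := ENNReal.toReal_pos (one_pos.trans_le hp).ne' hptop
    -- The noncentered operator also sees the even pieces. They are controlled through `hc κ ≤ h κ`
    -- for `κ < 2`, and none of them matters for `κ ≥ 2` because `τc n ≤ 2`.
    obtain ⟨q'', hq'', hev'⟩ : ∃ q'' < p.toReal, ∀ᶠ n in atTop, κ < τc n → ec n ≤ q'' := by
      rcases lt_or_ge κ 2 with hκ2 | hκ2
      · exact (hcrect κ ⟨hκ.1, hκ2⟩ p.toReal).2
          ((hc_le_h κ ⟨hκ.1, hκ2.le⟩).trans_lt hlt')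
      · exact ⟨q', hq', Eventually.of_forall fun n hn =>
          absurd (hn.trans_le (τc_le n)) (not_lt.2 hκ2)⟩
    obtain ⟨K, hK, hKS⟩ := StarShape.exists_measure_piece_le (D := D) rfl e_ge hq0
      (max_lt hq' hq'') (S := {n | κ < D.far n}) (by
        filter_upwards [half_tendsto.eventually hev, half_tendsto.eventually hev'] with n hn hn' hnS
        by_cases heven : Even n
        · rw [e_even n heven]
          exact (hn' (far_even n heven ▸ hnS)).trans (le_max_right _ _)
        · rw [e_odd n heven]
          exact (hn (far_odd n heven ▸ hnS)).trans (le_max_left _ _))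
    exact StarShape.isWeakType_noncenteredMaximal hκ.1 hp hptop hK hKS
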